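/- A simplicial set is called *finite* if it has only finitely many non-degenerate simplices. Let $\operatorname{Sd}$ denote Kan's normal subdivision, i.e. the functor from simplicial sets to simplicial sets which is the left Kan extension, along the Yoneda embedding $[n] \mapsto \Delta[n]$, of the functor sending $[n]$ to the nerve of the set of non-empty subsets of $\{0, \dots, n\}$ partially ordered by inclusion. A map $f \colon A \to B$ of finite simplicial sets is called *simple* if its geometric realization $|f| \colon |A| \to |B|$ has contractible point inverses: the preimage $|f|^{-1}(b)$ is contractible (in particular non-empty) for each point $b \in |B|$. **Theorem.** Let $X$ and $Y$ be finite simplicial sets, with product projections $\mathrm{pr}_1 \colon X \times Y \to X$ and $\mathrm{pr}_2 \colon X \times Y \to Y$. Then the canonical map $$\kappa = (\operatorname{Sd}(\mathrm{pr}_1), \operatorname{Sd}(\mathrm{pr}_2)) \colon \operatorname{Sd}(X \times Y) \longrightarrow \operatorname{Sd} X \times \operatorname{Sd} Y$$ is a simple map. (In particular, $\operatorname{Sd}(X \times Y)$ and $\operatorname{Sd} X \times \operatorname{Sd} Y$ are finite.) -/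

import Mathlib

open CategoryTheory MonoidalCategory

universe u

/-- The canonical map `κ : Sd (X × Y) ⟶ Sd X × Sd Y`, whose components are the maps induced
by the two projections. Here `⊗` is the (levelwise) cartesian product of simplicial sets and
`SSet.sd` is Kan's normal subdivision: the left Kan extension along the Yoneda embedding of
the functor which takes `[n]` to the nerve of the poset of nonempty subsets of `{0, …, n}`. -/
noncomputable def SSet.sdProdComparison (X Y : SSet.{u}) :
    SSet.sd.obj (X ⊗ Y) ⟶ SSet.sd.obj X ⊗ SSet.sd.obj Y :=
  CartesianMonoidalCategory.lift (SSet.sd.map (CartesianMonoidalCategory.fst X Y))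
    (SSet.sd.map (CartesianMonoidalCategory.snd X Y))

/-- A map of finite simplicial sets is simple if every point inverse of its geometric
realization is contractible (and so, in particular, nonempty). -/
structure SSet.IsSimpleMap {A B : SSet.{u}} (f : A ⟶ B) : Prop where
  finite_source : A.Finite
  finite_target : B.Finite
  contractible_preimage : ∀ b : SSet.toTop.obj B,
    ContractibleSpace ((SSet.toTop.map f) ⁻¹' {b} : Set (SSet.toTop.obj A))

/-!
The point inverses of `|κ|` are computed in coordinates, and the resulting spaces of matrices are
shown to be contractible by induction.

*Coordinates.* The realization of the nerve of the poset of nonempty subsets of `{0, …, n}` is the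
space of functions `h : {0, …, n} → [0, 1]` with maximum `1`: the point `∑ r, t r • U r` of a flag
`U` corresponds to `∑ r, t r • 1_{U r}`, and the flag is recovered from the superlevel sets
(`flag_unique`, `exists_flag`). A map `θ` of simplices acts by taking maxima over the fibres of `θ`
(`SSet.flagCoord_map`). Since `|Sd (-)|` preserves colimits, the points of `|Sd (Δ[m] × Δ[n])|`
become matrices with entries in `[0, 1]` and maximum `1` whose nonzero entries form a chain in the
product order, and the two projections take row maxima and column maxima (`SSet.sdCoord_map_fst`,
`SSet.sdCoord_map_snd`). So the fibres of `κ` for a pair of simplices are the spaces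
`chainMatrices h₁ h₂` of such matrices with given row and column maxima.

*Reduction to simplices.* A functor from simplicial sets to spaces which preserves colimits and
has a sensible notion of support on simplices (`SSet.SupportData`) takes `X` to the disjoint union
of the interiors of its nondegenerate cells (`SSet.SupportData.exists_normalForm`,
`SSet.SupportData.normalForm_unique`). Applied to `|-|` this shows that a point of `|A × B|` is
determined by its two projections (`SSet.toTop_prod_ext`); this is all that is needed about
realizations of products, and it identifies the fibres of `|κ|` with the common fibres of
the two maps `|Sd pr₁|` and `|Sd pr₂|`. Applied to `|Sd (-)|` it shows that the fibre
over a point in the interiors of the cells of `x` and `y` is homeomorphic to the fibre for the pair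
of simplices `x`, `y` (`SSet.nonempty_simplexFibre_homeo_prodFibre`).

*Contractibility.* For `max h₁ = max h₂` the space `chainMatrices h₁ h₂` is an absolute extensor for
metric spaces (`IsAbsoluteExtensor`), hence contractible. This is proved by induction on the number
of rows and columns. Let `(r, s)` be the last corner. A chain cannot continue both along the row
`r` and along the column `s`, so the matrices split into at most three closed pieces, according
to which of the two vanishes apart from the corner and whether the corner entry is maximal. Each
piece is a product of an interval with a smaller space of the same kind, and so is each
intersection. For the induction to close up, it is carried out
(`isAbsoluteExtensor_exact_and_relaxed`) together with the variant in which the last row has only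
an upper bound for its maximum.
-/

open Simplicial Opposite Limits
open scoped NNReal

/-! ### Cells -/

lemma SimplexCategory.exists_mono_of_finset {n : SimplexCategory} (S : Finset (Fin (n.len + 1)))
    (hS : S.Nonempty) : ∃ (k : ℕ) (ι : ⦋k⦌ ⟶ n), Mono ι ∧ Set.range ι.toOrderHom = S := by
  have hk : S.card = (S.card - 1) + 1 := (Nat.succ_pred_eq_of_pos hS.card_pos).symm
  refine ⟨S.card - 1, Hom.mk (S.orderEmbOfFin hk).toOrderHom, ?_, ?_⟩
  · rw [mono_iff_injective]
    exact (S.orderEmbOfFin hk).injective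
  · exact S.range_orderEmbOfFin hk

namespace SimplexCategory

lemma exists_retraction {m n : SimplexCategory} (θ : m ⟶ n) [Mono θ] :
    ∃ r : n ⟶ m, θ ≫ r = 𝟙 m := by
  have hθ : StrictMono θ.toOrderHom :=
    θ.toOrderHom.monotone.strictMono_of_injective (mono_iff_injective.mp inferInstance)
  refine ⟨Hom.mk ⟨fun j => (Finset.univ.filter fun i => θ.toOrderHom i ≤ j).sup id,
    fun a b hab => Finset.sup_mono fun i hi => ?_⟩, ?_⟩
  · simp only [Finset.mem_filter, Finset.mem_univ, true_and] at hi ⊢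
    exact hi.trans hab
  · ext i : 3
    change (Finset.univ.filter fun i' => θ.toOrderHom i' ≤ θ.toOrderHom i).sup id = i
    apply le_antisymm
    · refine Finset.sup_le fun j hj => ?_
      simpa [hθ.le_iff_le] using hj
    · exact Finset.le_sup (f := id) (by simp)

lemma exists_epi_mono_factorisation {m n : SimplexCategory} (θ : m ⟶ n) :
    ∃ (k : ℕ) (e : m ⟶ ⦋k⦌) (i : ⦋k⦌ ⟶ n), Epi e ∧ Mono i ∧ e ≫ i = θ :=
  ⟨(image θ).len, factorThruImage θ, image.ι θ, inferInstanceAs (Epi (factorThruImage θ)),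
    inferInstanceAs (Mono (image.ι θ)), image.fac θ⟩

/-- A face operator is determined by the set of its vertices. -/
lemma mono_ext_of_range_eq {k k' : ℕ} {n : SimplexCategory} (ι : ⦋k⦌ ⟶ n) (ι' : ⦋k'⦌ ⟶ n)
    [Mono ι] [Mono ι'] (h : Set.range ι.toOrderHom = Set.range ι'.toOrderHom) :
    ∃ e : k = k', ι = eqToHom (by rw [e]) ≫ ι' := by
  have hι : Function.Injective ι.toOrderHom := mono_iff_injective.mp inferInstance
  have hι' : Function.Injective ι'.toOrderHom := mono_iff_injective.mp inferInstance
  have hk : k = k' := by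
    have := congrArg Set.ncard h
    rw [Set.ncard_range_of_injective hι, Set.ncard_range_of_injective hι'] at this
    simpa using this
  subst hk
  refine ⟨rfl, ?_⟩
  ext i : 3
  have : (ι.toOrderHom : Fin (k + 1) → Fin (n.len + 1)) = ι'.toOrderHom :=
    (StrictMono.range_inj (ι.toOrderHom.monotone.strictMono_of_injective hι)
      (ι'.toOrderHom.monotone.strictMono_of_injective hι')).mp h
  simpa using congrFun this i

end SimplexCategory

namespace SSet

variable (L : SSet.{u} ⥤ TopCat.{u}) {X Y : SSet.{u}}

/-- The characteristic map `L Δ[n] ⟶ L X` of a simplex of `X`, for a functor `L`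
from simplicial sets to topological spaces. -/
noncomputable def cell {n : SimplexCategory} (x : X.obj (op n)) :
    L.obj (SSet.stdSimplex.obj n) ⟶ L.obj X :=
  L.map (yonedaEquiv.symm x)

/-- The map `L Δ[m] ⟶ L Δ[n]` induced by a simplicial operator. -/
noncomputable def push {m n : SimplexCategory} (θ : m ⟶ n) :
    L.obj (SSet.stdSimplex.obj m) ⟶ L.obj (SSet.stdSimplex.obj n) :=
  L.map (SSet.stdSimplex.map θ)

lemma map_cell {n : SimplexCategory} (x : X.obj (op n)) (f : X ⟶ Y)
    (d : L.obj (SSet.stdSimplex.obj n)) :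
    L.map f (cell L x d) = cell L (f.app _ x) d := by
  rw [cell, cell, ← yonedaEquiv_symm_comp, L.map_comp]
  rfl

lemma cell_map {m n : SimplexCategory} (θ : m ⟶ n) (x : X.obj (op n))
    (d : L.obj (SSet.stdSimplex.obj m)) :
    cell L (X.map θ.op x) d = cell L x (push L θ d) := by
  rw [cell, cell, ← yonedaEquiv_symm_naturality_left, L.map_comp]
  rfl

lemma push_comp {k m n : SimplexCategory} (θ : k ⟶ m) (η : m ⟶ n)
    (d : L.obj (SSet.stdSimplex.obj k)) :
    push L (θ ≫ η) d =
      push L η (push L θ d) := by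
  have h : SSet.stdSimplex.{u}.map (θ ≫ η) = SSet.stdSimplex.map θ ≫ SSet.stdSimplex.map η :=
    Functor.map_comp _ _ _
  rw [push, h, L.map_comp]
  rfl

@[simp]
lemma push_id {n : SimplexCategory} (d : L.obj (SSet.stdSimplex.obj n)) :
    push L (𝟙 n) d = d := by
  have h : SSet.stdSimplex.{u}.map (𝟙 n) = 𝟙 _ := CategoryTheory.Functor.map_id _ _
  rw [push, h, L.map_id]
  rfl

lemma push_injective {m n : SimplexCategory} (θ : m ⟶ n) [Mono θ] :
    Function.Injective (push L θ) := by
  obtain ⟨r, hr⟩ := SimplexCategory.exists_retraction θ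
  intro a b h
  rw [← push_id L a, ← hr, push_comp, h, ← push_comp, hr, push_id]

variable [L.IsLeftAdjoint]

/-- As `L` preserves colimits, a continuous map out of `L X` may be defined on cells. -/
lemma exists_desc {T : Type u} [TopologicalSpace T]
    (g : ∀ (n : SimplexCategory) (_ : X.obj (op n)), C(L.obj (SSet.stdSimplex.obj n), T))
    (hg : ∀ (m n : SimplexCategory) (θ : m ⟶ n) (x : X.obj (op n)) (d),
      g m (X.map θ.op x) d = g n x (push L θ d)) :
    ∃ G : C(L.obj X, T), ∀ n (x : X.obj (op n)) d, G (cell L x d) = g n x d := by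
  let adj := Adjunction.ofIsLeftAdjoint L
  let φ : X ⟶ (Functor.rightAdjoint L).obj (TopCat.of T) :=
    { app := fun n => TypeCat.ofHom fun x =>
        yonedaEquiv (adj.homEquiv _ _ (TopCat.ofHom (g n.unop x)))
      naturality := by
        intro n m θ
        ext x
        change yonedaEquiv _ = ((Functor.rightAdjoint L).obj (TopCat.of T)).map θ.unop.op
          (yonedaEquiv _)
        rw [yonedaEquiv_naturality, ← Adjunction.homEquiv_naturality_left]
        congr 2
        ext d
        exact hg _ _ θ.unop x d }
  refine ⟨((adj.homEquiv _ _).symm φ).hom, fun n x d => ?_⟩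
  have h : cell L x ≫ (adj.homEquiv _ _).symm φ = TopCat.ofHom (g n x) := by
    rw [cell, ← Adjunction.homEquiv_naturality_left_symm, yonedaEquiv_symm_comp,
      Equiv.symm_apply_eq]
    exact yonedaEquiv.symm_apply_apply _
  exact ConcreteCategory.congr_hom h d

/-- The cells cover `L X`: otherwise, two maps from `L X` to an indiscrete space would agree on all
cells without being equal. -/
lemma exists_cell (p : L.obj X) : ∃ (n : ℕ) (x : X _⦋n⦌) (d : L.obj Δ[n]), cell L x d = p := by
  let adj := Adjunction.ofIsLeftAdjoint L
  by_contra! h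
  let T := TopCat.trivial.obj (ULift.{u} Prop)
  let f : L.obj X ⟶ T := TopCat.ofHom (Y := T) ⟨fun q => ⟨q = p⟩, continuous_top⟩
  let g : L.obj X ⟶ T := TopCat.ofHom (Y := T) ⟨fun q => ⟨False⟩, continuous_top⟩
  have hfg : f = g := by
    apply (adj.homEquiv _ _).injective
    ext n x
    induction n using Opposite.rec with | op n
    apply yonedaEquiv.symm.injective
    refine (yonedaEquiv_symm_comp (X := X) (n := n) x (adj.homEquiv _ _ f)).symm.trans
      (Eq.trans ?_ (yonedaEquiv_symm_comp (X := X) (n := n) x (adj.homEquiv _ _ g)))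
    rw [← Adjunction.homEquiv_naturality_left,
      ← Adjunction.homEquiv_naturality_left]
    congr 1
    ext d
    have : cell L x d ≠ p := h n.len x d
    exact congrArg ULift.up (propext ⟨fun h => this h, False.elim⟩)
  have := congrArg ULift.down (ConcreteCategory.congr_hom hfg p)
  exact this.mp rfl

/-- The cells determine the topology of `L X`. -/
lemma isClosed_of_cell {C : Set (L.obj X)}
    (hC : ∀ (n : ℕ) (x : X _⦋n⦌), IsClosed (cell L x ⁻¹' C)) : IsClosed C := by
  -- the characteristic function of `Cᶜ`, with values in the Sierpiński space
  let g (n : SimplexCategory) (x : X.obj (op n)) :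
      C(L.obj (SSet.stdSimplex.obj n), ULift.{u} Prop) :=
    ⟨fun d => ⟨cell L x d ∈ Cᶜ⟩,
      continuous_uliftUp.comp (continuous_Prop.mpr (hC n.len x).isOpen_compl)⟩
  obtain ⟨G, hG⟩ := exists_desc L g (fun m n θ x d => by
    change ULift.up _ = ULift.up _
    rw [cell_map])
  have hGC : ∀ p, (G p).down ↔ p ∈ Cᶜ := fun p => by
    obtain ⟨n, x, d, rfl⟩ := exists_cell L p
    rw [hG]
    rfl
  rw [← isOpen_compl_iff]
  have := continuous_Prop.mp (continuous_uliftDown.comp G.continuous)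
  convert! this using 1
  ext p
  exact (hGC p).symm

/-- Descent along cells, for mere functions. -/
lemma exists_desc_fun {T : Type u}
    (g : ∀ (n : SimplexCategory) (_ : X.obj (op n)), L.obj (SSet.stdSimplex.obj n) → T)
    (hg : ∀ (m n : SimplexCategory) (θ : m ⟶ n) (x : X.obj (op n)) (d),
      g m (X.map θ.op x) d = g n x (push L θ d)) :
    ∃ G : L.obj X → T, ∀ n (x : X.obj (op n)) d, G (cell L x d) = g n x d := by
  let _ : TopologicalSpace T := ⊤
  obtain ⟨G, hG⟩ := exists_desc L (fun n x => ⟨g n x, continuous_top⟩) hg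
  exact ⟨G, hG⟩

/-- Descent along cells, for continuous maps to a small space. -/
lemma exists_desc_small {T : Type} [TopologicalSpace T]
    (g : ∀ (n : SimplexCategory) (_ : X.obj (op n)), L.obj (SSet.stdSimplex.obj n) → T)
    (hc : ∀ n x, Continuous (g n x))
    (hg : ∀ (m n : SimplexCategory) (θ : m ⟶ n) (x : X.obj (op n)) (d),
      g m (X.map θ.op x) d = g n x (push L θ d)) :
    ∃ G : L.obj X → T, Continuous G ∧ ∀ n (x : X.obj (op n)) d, G (cell L x d) = g n x d := by
  obtain ⟨G, hG⟩ := exists_desc (T := ULift.{u} T) L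
    (fun n x => ⟨fun d => ⟨g n x d⟩, continuous_uliftUp.comp (hc n x)⟩)
    (fun m n θ x d => congrArg ULift.up (hg m n θ x d))
  exact ⟨fun p => (G p).down, continuous_uliftDown.comp G.continuous,
    fun n x d => congrArg ULift.down (hG n x d)⟩

end SSet

/-! ### Normal forms of points -/

namespace SSet

/-- A notion of support for the points of the spaces `L Δ[n]`: the support of a point is the set
of vertices of the smallest face that contains it, so that every point comes from a point with full
support of some face. -/
structure SupportData (L : SSet.{u} ⥤ TopCat.{u}) where
  /-- The support of a point of `L Δ[n]`. -/
  supp {n : SimplexCategory} : L.obj (SSet.stdSimplex.obj n) → Set (Fin (n.len + 1))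
  supp_push {m n : SimplexCategory} (θ : m ⟶ n) (d : L.obj (SSet.stdSimplex.obj m)) :
    supp (push L θ d) = θ.toOrderHom '' supp d
  exists_full {n : SimplexCategory} (d : L.obj (SSet.stdSimplex.obj n)) :
    ∃ (k : ℕ) (ι : ⦋k⦌ ⟶ n) (d₀ : L.obj Δ[k]), Mono ι ∧ supp d₀ = Set.univ ∧ push L ι d₀ = d

namespace SupportData

variable {L : SSet.{u} ⥤ TopCat.{u}} (D : SupportData L) {X : SSet.{u}}

lemma supp_push_of_epi {m n : SimplexCategory} (θ : m ⟶ n) [Epi θ]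
    {d : L.obj (SSet.stdSimplex.obj m)} (hd : D.supp d = Set.univ) :
    D.supp (push L θ d) = Set.univ := by
  rw [D.supp_push, hd, Set.image_univ, Set.range_eq_univ]
  exact SimplexCategory.epi_iff_surjective.mp inferInstance

/-- `D.Reduces x d x' d'` says that `(x', d')` is obtained from `(x, d)` by restricting to the
support of `d` and then collapsing along the degeneracy of the restriction of `x`. -/
def Reduces {n : SimplexCategory} (x : X.obj (op n)) (d : L.obj (SSet.stdSimplex.obj n))
    (z : Σ k : ℕ, X _⦋k⦌ × L.obj Δ[k]) : Prop :=
  ∃ (k : ℕ) (ι : ⦋k⦌ ⟶ n) (d₀ : L.obj Δ[k]) (σ : ⦋k⦌ ⟶ ⦋z.1⦌), Mono ι ∧ Epi σ ∧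
    D.supp d₀ = Set.univ ∧ push L ι d₀ = d ∧ X.map ι.op x = X.map σ.op z.2.1 ∧
    z.2.1 ∈ X.nonDegenerate _ ∧ push L σ d₀ = z.2.2

variable {D}

lemma Reduces.unique {n : SimplexCategory} {x : X.obj (op n)} {d : L.obj (SSet.stdSimplex.obj n)}
    {z z' : Σ k : ℕ, X _⦋k⦌ × L.obj Δ[k]} (h : D.Reduces x d z) (h' : D.Reduces x d z') :
    z = z' := by
  obtain ⟨k, ι, d₀, σ, hι, hσ, hd₀, rfl, hx, hz, hz₂⟩ := h
  obtain ⟨k', ι', d₀', σ', hι', hσ', hd₀', h', hx', hz', hz₂'⟩ := h'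
  have hr : Set.range ι.toOrderHom = Set.range ι'.toOrderHom := by
    have := congrArg D.supp h'
    rw [D.supp_push, D.supp_push, hd₀, hd₀', Set.image_univ, Set.image_univ] at this
    exact this.symm
  obtain ⟨rfl, he⟩ := SimplexCategory.mono_ext_of_range_eq ι ι' hr
  rw [eqToHom_refl, Category.id_comp] at he
  subst he
  obtain rfl := push_injective L ι h'
  obtain ⟨m, y, e⟩ := z
  obtain ⟨m', y', e'⟩ := z'
  dsimp only at *
  obtain rfl := X.unique_nonDegenerate_dim _ σ ⟨y, hz⟩ hx σ' ⟨y', hz'⟩ hx'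
  obtain rfl : y = y' :=
    congrArg Subtype.val (X.unique_nonDegenerate_simplex _ σ ⟨y, hz⟩ hx σ' ⟨y', hz'⟩ hx')
  obtain rfl := X.unique_nonDegenerate_map _ σ ⟨y, hz⟩ hx σ' ⟨y, hz'⟩ hx'
  rw [← hz₂, ← hz₂']

variable (D) in
/-- The two representatives `(θ^* x, d)` and `(x, θ_* d)` of a point have a common reduction. -/
lemma exists_reduces {m n : SimplexCategory} (θ : m ⟶ n) (x : X.obj (op n))
    (d : L.obj (SSet.stdSimplex.obj m)) :
    ∃ z, D.Reduces (X.map θ.op x) d z ∧ D.Reduces x (push L θ d) z := by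
  obtain ⟨k, ι, d₀, hι, hd₀, rfl⟩ := D.exists_full d
  obtain ⟨l, ρ, ι', hρ, hι', hfac⟩ := SimplexCategory.exists_epi_mono_factorisation (ι ≫ θ)
  obtain ⟨r, σ, hσ, y, hy⟩ := X.exists_nonDegenerate (X.map ι'.op x)
  refine ⟨⟨r, y, push L (ρ ≫ σ) d₀⟩,
    ⟨k, ι, d₀, ρ ≫ σ, hι, epi_comp _ _, hd₀, rfl, ?_, y.2, rfl⟩,
    ⟨l, ι', push L ρ d₀, σ, hι', hσ, D.supp_push_of_epi ρ hd₀, ?_, hy, y.2, ?_⟩⟩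
  · rw [op_comp, Functor.map_comp_apply, ← hy, ← Functor.map_comp_apply, ← Functor.map_comp_apply,
      ← op_comp, ← op_comp, hfac]
  · rw [← push_comp, ← push_comp, hfac]
  · rw [push_comp]

lemma Reduces.of_full {n : ℕ} {x : X _⦋n⦌} (hx : x ∈ X.nonDegenerate n) {d : L.obj Δ[n]}
    (hd : D.supp d = Set.univ) : D.Reduces (n := ⦋n⦌) x d ⟨n, x, d⟩ :=
  ⟨n, 𝟙 _, d, 𝟙 _, inferInstance, inferInstance, hd, by simp, by simp, hx, by simp⟩

lemma Reduces.cell_eq {n : SimplexCategory} {x : X.obj (op n)}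
    {d : L.obj (SSet.stdSimplex.obj n)} {z : Σ k : ℕ, X _⦋k⦌ × L.obj Δ[k]}
    (h : D.Reduces x d z) : cell L x d = cell L z.2.1 z.2.2 := by
  obtain ⟨k, ι, d₀, σ, hι, hσ, hd₀, rfl, hx, hz, hz₂⟩ := h
  rw [← cell_map, hx, cell_map, hz₂]

variable (D)

/-- Every point of `L X` lies in the interior of a nondegenerate cell. -/
lemma exists_normalForm [L.IsLeftAdjoint] (p : L.obj X) :
    ∃ (n : ℕ) (x : X _⦋n⦌) (d : L.obj Δ[n]),
      x ∈ X.nonDegenerate n ∧ D.supp d = Set.univ ∧ cell L x d = p := by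
  obtain ⟨n, x, d, rfl⟩ := exists_cell L p
  obtain ⟨⟨m, y, e⟩, -, h⟩ := D.exists_reduces (𝟙 _) x d
  rw [push_id] at h
  refine ⟨m, y, e, ?_, ?_, h.cell_eq.symm⟩
  · obtain ⟨k, ι, d₀, σ, hι, hσ, hd₀, rfl, hx, hz, hz₂⟩ := h
    exact hz
  · obtain ⟨k, ι, d₀, σ, hι, hσ, hd₀, rfl, hx, hz, hz₂⟩ := h
    exact (congrArg D.supp hz₂).symm.trans (D.supp_push_of_epi σ hd₀)

/-- The interiors of distinct nondegenerate cells of `L X` are disjoint, and each of them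
embeds in `L X`. -/
lemma normalForm_unique [L.IsLeftAdjoint] {n n' : ℕ} {x : X _⦋n⦌} {x' : X _⦋n'⦌}
    {d : L.obj Δ[n]} {d' : L.obj Δ[n']} (hx : x ∈ X.nonDegenerate n) (hx' : x' ∈ X.nonDegenerate n')
    (hd : D.supp d = Set.univ) (hd' : D.supp d' = Set.univ) (h : cell L x d = cell L x' d') :
    (⟨n, x, d⟩ : Σ k : ℕ, X _⦋k⦌ × L.obj Δ[k]) = ⟨n', x', d'⟩ := by
  have hex (m : SimplexCategory) (y : X.obj (op m)) (e) : ∃ z, D.Reduces y e z := by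
    obtain ⟨z, -, hz⟩ := D.exists_reduces (𝟙 _) y e
    exact ⟨z, by simpa using hz⟩
  choose g hg using hex
  obtain ⟨G, hG⟩ := exists_desc_fun L g (fun m n θ y e => by
    obtain ⟨z, hz, hz'⟩ := D.exists_reduces θ y e
    rw [(hg _ _ _).unique hz, (hg _ _ _).unique hz'])
  have e₁ := (hg ⦋n⦌ x d).unique (Reduces.of_full hx hd)
  have e₂ := (hg ⦋n'⦌ x' d').unique (Reduces.of_full hx' hd')
  rw [← e₁, ← e₂, ← hG, ← hG, h]

end SupportData

end SSet

/-! ### Weighted chains -/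

/-- A strictly increasing chain with positive weights is determined by the function which takes the
weight of each element of the chain and vanishes elsewhere. -/
lemma weightedChain_unique {P : Type*} [PartialOrder P] {n n' : ℕ} {f : Fin (n + 1) → P}
    {f' : Fin (n' + 1) → P} (hf : StrictMono f) (hf' : StrictMono f') {t : Fin (n + 1) → ℝ}
    {t' : Fin (n' + 1) → ℝ} (ht : ∀ r, t r ≠ 0) (ht' : ∀ r, t' r ≠ 0) {W : P → ℝ}
    (hW : ∀ r, W (f r) = t r) (hW' : ∀ r, W (f' r) = t' r)
    (h : ∀ p, W p ≠ 0 → p ∈ Set.range f) (h' : ∀ p, W p ≠ 0 → p ∈ Set.range f') :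
    (⟨n, f, t⟩ : Σ k : ℕ, (Fin (k + 1) → P) × (Fin (k + 1) → ℝ)) = ⟨n', f', t'⟩ := by
  have hr : Set.range f = Set.range f' := by
    apply Set.Subset.antisymm
    · rintro _ ⟨r, rfl⟩
      exact h' _ (by rw [hW]; exact ht r)
    · rintro _ ⟨r, rfl⟩
      exact h _ (by rw [hW']; exact ht' r)
  obtain rfl : n = n' := by
    have := congrArg Set.ncard hr
    rw [Set.ncard_range_of_injective hf.injective,
      Set.ncard_range_of_injective hf'.injective] at this
    simpa using this
  obtain rfl := (StrictMono.range_inj hf hf').mp hr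
  obtain rfl : t = t' := funext fun r => (hW r).symm.trans (hW' r)
  rfl

/-- A function is determined by its sums over the initial segments. -/
lemma eq_of_sum_Iic_eq {P : Type*} [PartialOrder P] [LocallyFiniteOrderBot P] [WellFoundedLT P]
    {w w' : P → ℝ} (h : ∀ p, ∑ q ∈ Finset.Iic p, w q = ∑ q ∈ Finset.Iic p, w' q) : w = w' := by
  classical
  funext p
  induction p using WellFoundedLT.induction with
  | ind p ih =>
    have := h p
    rw [← Finset.Iio_insert, Finset.sum_insert (by simp), Finset.sum_insert (by simp),
      Finset.sum_congr rfl fun q hq => ih q (Finset.mem_Iio.mp hq)] at this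
    exact add_right_cancel this

/-- The total weight that a monotone chain puts on a quadrant is the smaller one of the weights on
the two half-planes, since the sets of indices which fall in these are nested. -/
lemma sum_filter_le_and_le {n : ℕ} {P Q : Type*} [LinearOrder P] [LinearOrder Q]
    {σ : Fin n → P} {τ : Fin n → Q} (hσ : Monotone σ) (hτ : Monotone τ)
    {t : Fin n → ℝ} (ht : ∀ r, 0 ≤ t r) (i : P) (j : Q) :
    ∑ r with σ r ≤ i ∧ τ r ≤ j, t r = min (∑ r with σ r ≤ i, t r) (∑ r with τ r ≤ j, t r) := by
  rw [Finset.filter_and]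
  by_cases h : ∀ r, σ r ≤ i → τ r ≤ j
  · have hsub : Finset.univ.filter (fun r => σ r ≤ i) ⊆ Finset.univ.filter (fun r => τ r ≤ j) :=
      fun r hr => by simpa using h r (by simpa using hr)
    rw [Finset.inter_eq_left.mpr hsub, min_eq_left]
    exact Finset.sum_le_sum_of_subset_of_nonneg hsub fun _ _ _ => ht _
  · push Not at h
    obtain ⟨r₀, h₁, h₂⟩ := h
    have hsub : Finset.univ.filter (fun r => τ r ≤ j) ⊆ Finset.univ.filter (fun r => σ r ≤ i) := by
      intro r hr
      simp only [Finset.mem_filter, Finset.mem_univ, true_and] at hr ⊢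
      refine (hσ (le_of_not_gt fun hlt => ?_)).trans h₁
      exact absurd ((hτ hlt.le).trans hr) h₂.not_ge
    rw [Finset.inter_eq_right.mpr hsub, min_eq_right]
    exact Finset.sum_le_sum_of_subset_of_nonneg hsub fun _ _ _ => ht _

lemma strictMono_prodMk {n : ℕ} {P Q : Type*} [PartialOrder P] [PartialOrder Q]
    {σ : Fin n → P} {τ : Fin n → Q} (hσ : Monotone σ) (hτ : Monotone τ)
    (hinj : ∀ r s, σ r = σ s → τ r = τ s → r = s) : StrictMono fun r => (σ r, τ r) :=
  Monotone.strictMono_of_injective (fun _ _ h => ⟨hσ h, hτ h⟩)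
    fun r s h => hinj r s (congrArg Prod.fst h) (congrArg Prod.snd h)

/-- The distribution function of the pushforward of a weight is the sum over a half-line. -/
lemma sum_Iic_sum_filter {n : ℕ} {P : Type*} [PartialOrder P] [LocallyFiniteOrderBot P]
    [DecidableLE P] [DecidableEq P] (f : Fin n → P) (t : Fin n → ℝ) (p : P) :
    ∑ q ∈ Finset.Iic p, ∑ r with f r = q, t r = ∑ r with f r ≤ p, t r := by
  rw [← Finset.sum_fiberwise_of_maps_to (s := Finset.univ.filter fun r => f r ≤ p)
    (t := Finset.Iic p) (g := f) (by simp)]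
  refine Finset.sum_congr rfl fun q hq => Finset.sum_congr ?_ fun _ _ => rfl
  ext r
  simp only [Finset.mem_filter, Finset.mem_univ, true_and, iff_and_self]
  rintro rfl
  exact Finset.mem_Iic.mp hq

/-- A weight carried by a chain in a product of two linear orders is determined by its two
marginals, because its distribution function is the minimum of theirs. -/
lemma coupling_unique {n n' m l : ℕ} {σ : Fin (n + 1) → Fin (m + 1)} {τ : Fin (n + 1) → Fin (l + 1)}
    {σ' : Fin (n' + 1) → Fin (m + 1)} {τ' : Fin (n' + 1) → Fin (l + 1)}
    (hσ : Monotone σ) (hτ : Monotone τ) (hσ' : Monotone σ') (hτ' : Monotone τ')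
    (hinj : ∀ r s, σ r = σ s → τ r = τ s → r = s)
    (hinj' : ∀ r s, σ' r = σ' s → τ' r = τ' s → r = s)
    {t : Fin (n + 1) → ℝ} {t' : Fin (n' + 1) → ℝ} (ht : ∀ r, 0 < t r) (ht' : ∀ r, 0 < t' r)
    (h₁ : ∀ i, ∑ r with σ r = i, t r = ∑ r with σ' r = i, t' r)
    (h₂ : ∀ j, ∑ r with τ r = j, t r = ∑ r with τ' r = j, t' r) :
    (⟨n, fun r => (σ r, τ r), t⟩ :
      Σ k : ℕ, (Fin (k + 1) → Fin (m + 1) × Fin (l + 1)) × (Fin (k + 1) → ℝ)) =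
      ⟨n', fun r => (σ' r, τ' r), t'⟩ := by
  let W (p : Fin (m + 1) × Fin (l + 1)) : ℝ := ∑ r with (σ r, τ r) = p, t r
  let W' (p : Fin (m + 1) × Fin (l + 1)) : ℝ := ∑ r with (σ' r, τ' r) = p, t' r
  have hWW : W = W' := by
    apply eq_of_sum_Iic_eq
    rintro ⟨i, j⟩
    simp only [W, W']
    rw [sum_Iic_sum_filter, sum_Iic_sum_filter]
    simp only [Prod.mk_le_mk]
    rw [sum_filter_le_and_le hσ hτ (fun r => (ht r).le),
      sum_filter_le_and_le hσ' hτ' (fun r => (ht' r).le), ← sum_Iic_sum_filter σ,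
      ← sum_Iic_sum_filter τ, ← sum_Iic_sum_filter σ', ← sum_Iic_sum_filter τ']
    simp only [h₁, h₂]
  have key {k : ℕ} {α : Fin (k + 1) → Fin (m + 1)} {β : Fin (k + 1) → Fin (l + 1)}
      (hinj : ∀ r s, α r = α s → β r = β s → r = s) (s : Fin (k + 1) → ℝ) (r : Fin (k + 1)) :
      ∑ r' with (α r', β r') = (α r, β r), s r' = s r := by
    rw [Finset.sum_eq_single r]
    · intro b hb hne
      simp only [Finset.mem_filter, Prod.mk.injEq] at hb
      exact absurd (hinj _ _ hb.2.1 hb.2.2) hne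
    · simp
  have key' {k : ℕ} {f : Fin (k + 1) → Fin (m + 1) × Fin (l + 1)} {s : Fin (k + 1) → ℝ} {p}
      (hp : ∑ r with f r = p, s r ≠ 0) : p ∈ Set.range f := by
    obtain ⟨r, hr, -⟩ := Finset.exists_ne_zero_of_sum_ne_zero hp
    exact ⟨r, (Finset.mem_filter.mp hr).2⟩
  exact weightedChain_unique (W := W) (strictMono_prodMk hσ hτ hinj)
    (strictMono_prodMk hσ' hτ' hinj') (fun r => (ht r).ne') (fun r => (ht' r).ne') (key hinj t)
    (fun r => by rw [hWW]; exact key hinj' t' r) (fun p => key') (fun p hp => key' (hWW ▸ hp))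

/-! ### Points of realizations of products -/

namespace SSet

lemma toTopHomeo_push_apply {m n : SimplexCategory} (θ : m ⟶ n)
    (d : SSet.toTop.{u}.obj (SSet.stdSimplex.obj m)) (j : Fin (n.len + 1)) :
    n.toTopHomeo (push SSet.toTop θ d) j =
      ∑ i with θ.toOrderHom i = j, m.toTopHomeo d i := by
  classical
  rw [push, SimplexCategory.toTopHomeo_naturality_apply, _root_.stdSimplex.map_coe,
    FunOnFinite.linearMap_apply_apply]
  rfl

/-- The support of a point of the realization of `Δ[n]` is the set of vertices at which its
barycentric coordinate is nonzero. -/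
noncomputable def toTopSupportData : SupportData SSet.toTop.{u} where
  supp {n} d := {i | n.toTopHomeo d i ≠ 0}
  supp_push {m n} θ d := by
    ext j
    simp only [Set.mem_ofPred_eq, Set.mem_image]
    rw [toTopHomeo_push_apply, Ne, Finset.sum_eq_zero_iff_of_nonneg (fun i _ => by simp)]
    simp only [Finset.mem_filter, Finset.mem_univ, true_and]
    push Not
    exact exists_congr fun i => and_comm
  exists_full {n} d := by
    classical
    let S : Finset (Fin (n.len + 1)) := Finset.univ.filter fun i => n.toTopHomeo d i ≠ 0
    have hsum : ∑ i ∈ S, n.toTopHomeo d i = 1 := by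
      rw [Finset.sum_filter_ne_zero]
      exact _root_.stdSimplex.sum_eq_one _
    have hS : S.Nonempty := Finset.nonempty_of_sum_ne_zero (hsum.trans_ne one_ne_zero)
    obtain ⟨k, ι, hι, hr⟩ := SimplexCategory.exists_mono_of_finset S hS
    have hinj : Function.Injective ι.toOrderHom := SimplexCategory.mono_iff_injective.mp hι
    have himg : Finset.univ.image ι.toOrderHom = S := by
      rw [← Finset.coe_inj, ← hr]
      simp
    let t : _root_.stdSimplex ℝ (Fin (k + 1)) := ⟨fun r => n.toTopHomeo d (ι.toOrderHom r),
      fun r => by simp, by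
        rw [← hsum, ← himg, Finset.sum_image (fun a _ b _ h => hinj h)]⟩
    refine ⟨k, ι, (SimplexCategory.toTopHomeo ⦋k⦌).symm t, hι, ?_, ?_⟩
    · ext r
      simp only [Homeomorph.apply_symm_apply, Set.mem_ofPred_eq, Set.mem_univ, iff_true]
      have : ι.toOrderHom r ∈ S := by
        rw [← himg]
        exact Finset.mem_image_of_mem _ (Finset.mem_univ r)
      exact (Finset.mem_filter.mp this).2
    · apply n.toTopHomeo.injective
      ext j
      rw [toTopHomeo_push_apply, Homeomorph.apply_symm_apply]
      change ∑ i with ι.toOrderHom i = j, n.toTopHomeo d (ι.toOrderHom i) = _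
      by_cases hj : j ∈ S
      · rw [← himg] at hj
        obtain ⟨r, -, rfl⟩ := Finset.mem_image.mp hj
        rw [Finset.sum_eq_single r]
        · intro b hb hne
          exact absurd (hinj (Finset.mem_filter.mp hb).2) hne
        · simp
      · rw [Finset.sum_eq_zero]
        · simpa [S, eq_comm] using hj
        · intro i hi
          refine absurd ?_ hj
          rw [← himg, ← (Finset.mem_filter.mp hi).2]
          exact Finset.mem_image_of_mem _ (Finset.mem_univ i)

end SSet

namespace SSet

variable {A B : SSet.{u}}

/-- If `(σ^* a, τ^* b)` is nondegenerate, then `σ` and `τ` are jointly injective. -/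
lemma injective_of_nonDegenerate_prod {n p q : ℕ} (σ : ⦋n⦌ ⟶ ⦋p⦌) (τ : ⦋n⦌ ⟶ ⦋q⦌) (a : A _⦋p⦌)
    (b : B _⦋q⦌)
    (h : ((A.map σ.op a, B.map τ.op b) : (A ⊗ B) _⦋n⦌) ∈ (A ⊗ B).nonDegenerate n)
    (r s : Fin (n + 1)) (h₁ : σ.toOrderHom r = σ.toOrderHom s)
    (h₂ : τ.toOrderHom r = τ.toOrderHom s) : r = s := by
  let z : (Δ[p] ⊗ Δ[q] : SSet.{u}) _⦋n⦌ := (stdSimplex.objEquiv.symm σ, stdSimplex.objEquiv.symm τ)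
  have hz : z ∈ (Δ[p] ⊗ Δ[q] : SSet.{u}).nonDegenerate n := by
    intro hz
    exact h (degenerate_app_apply hz (yonedaEquiv.symm a ⊗ₘ yonedaEquiv.symm b))
  rw [prodStdSimplex.nonDegenerate_iff_injective_objEquiv] at hz
  exact hz (Prod.ext h₁ h₂)

/-- If `σ` and `τ` are jointly injective degeneracy operators and `a` and `b` are nondegenerate,
then `(σ^* a, τ^* b)` is nondegenerate. -/
lemma nonDegenerate_prod_of_injective {n p q : ℕ} (σ : ⦋n⦌ ⟶ ⦋p⦌) (τ : ⦋n⦌ ⟶ ⦋q⦌) [Epi σ] [Epi τ]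
    {a : A _⦋p⦌} {b : B _⦋q⦌} (ha : a ∈ A.nonDegenerate p) (hb : b ∈ B.nonDegenerate q)
    (hinj : ∀ r s, σ.toOrderHom r = σ.toOrderHom s → τ.toOrderHom r = τ.toOrderHom s → r = s) :
    ((A.map σ.op a, B.map τ.op b) : (A ⊗ B) _⦋n⦌) ∈ (A ⊗ B).nonDegenerate n := by
  obtain ⟨k, ρ, hρ, ⟨⟨a₁, b₁⟩, hc⟩, h⟩ := (A ⊗ B).exists_nonDegenerate
    (n := n) (A.map σ.op a, B.map τ.op b)
  obtain ⟨p', σ', hσ', ⟨a', ha'⟩, rfl⟩ := A.exists_nonDegenerate a₁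
  obtain ⟨q', τ', hτ', ⟨b', hb'⟩, rfl⟩ := B.exists_nonDegenerate b₁
  have h₁ : A.map σ.op a = A.map (ρ ≫ σ').op a' := by
    rw [op_comp, Functor.map_comp_apply]
    exact congrArg Prod.fst h
  have h₂ : B.map τ.op b = B.map (ρ ≫ τ').op b' := by
    rw [op_comp, Functor.map_comp_apply]
    exact congrArg Prod.snd h
  have := epi_comp ρ σ'
  have := epi_comp ρ τ'
  obtain rfl := A.unique_nonDegenerate_dim _ σ ⟨a, ha⟩ rfl (ρ ≫ σ') ⟨a', ha'⟩ h₁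
  obtain rfl := B.unique_nonDegenerate_dim _ τ ⟨b, hb⟩ rfl (ρ ≫ τ') ⟨b', hb'⟩ h₂
  obtain rfl := A.unique_nonDegenerate_map _ σ ⟨a, ha⟩ rfl (ρ ≫ σ') ⟨a', ha'⟩ h₁
  obtain rfl := B.unique_nonDegenerate_map _ τ ⟨b, hb⟩ rfl (ρ ≫ τ') ⟨b', hb'⟩ h₂
  have hm : Mono ρ := SimplexCategory.mono_iff_injective.mpr fun r s hrs =>
    hinj r s (congrArg σ'.toOrderHom hrs) (congrArg τ'.toOrderHom hrs)
  obtain rfl := le_antisymm (SimplexCategory.le_of_mono ρ) (SimplexCategory.le_of_epi ρ)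
  obtain rfl := SimplexCategory.eq_id_of_mono ρ
  rw [h, op_id, CategoryTheory.Functor.map_id]
  exact hc

/-- A point of `|A ⊗ B|` is determined by its images in `|A|` and `|B|`. These determine the
nondegenerate simplices `a` and `b` below the point and the two marginals of the barycentric
coordinates, and the latter determine the chain of vertices and the coordinates. -/
lemma toTop_prod_ext {p p' : SSet.toTop.{u}.obj (A ⊗ B)}
    (h₁ : SSet.toTop.map (CartesianMonoidalCategory.fst A B) p =
      SSet.toTop.map (CartesianMonoidalCategory.fst A B) p')
    (h₂ : SSet.toTop.map (CartesianMonoidalCategory.snd A B) p =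
      SSet.toTop.map (CartesianMonoidalCategory.snd A B) p') : p = p' := by
  obtain ⟨n, ⟨a, b⟩, d, hc, hd, rfl⟩ := toTopSupportData.exists_normalForm p
  obtain ⟨n', ⟨a', b'⟩, d', hc', hd', rfl⟩ := toTopSupportData.exists_normalForm p'
  replace h₁ : cell SSet.toTop a d = cell SSet.toTop a' d' :=
    ((map_cell _ (X := A ⊗ B) (n := ⦋n⦌) (a, b) _ d).symm.trans h₁).trans
      (map_cell _ (X := A ⊗ B) (n := ⦋n'⦌) (a', b') _ d')
  replace h₂ : cell SSet.toTop b d = cell SSet.toTop b' d' :=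
    ((map_cell _ (X := A ⊗ B) (n := ⦋n⦌) (a, b) _ d).symm.trans h₂).trans
      (map_cell _ (X := A ⊗ B) (n := ⦋n'⦌) (a', b') _ d')
  obtain ⟨m, σ, hσ, ⟨a, ha⟩, rfl⟩ := A.exists_nonDegenerate a
  obtain ⟨m', σ', hσ', ⟨a', ha'⟩, rfl⟩ := A.exists_nonDegenerate a'
  obtain ⟨l, τ, hτ, ⟨b, hb⟩, rfl⟩ := B.exists_nonDegenerate b
  obtain ⟨l', τ', hτ', ⟨b', hb'⟩, rfl⟩ := B.exists_nonDegenerate b'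
  rw [cell_map, cell_map] at h₁ h₂
  have e₁ := toTopSupportData.normalForm_unique ha ha' (toTopSupportData.supp_push_of_epi σ hd)
    (toTopSupportData.supp_push_of_epi σ' hd') h₁
  have e₂ := toTopSupportData.normalForm_unique hb hb' (toTopSupportData.supp_push_of_epi τ hd)
    (toTopSupportData.supp_push_of_epi τ' hd') h₂
  obtain rfl : m = m' := congrArg Sigma.fst e₁
  obtain rfl : l = l' := congrArg Sigma.fst e₂
  simp only [Sigma.mk.injEq, heq_eq_eq, true_and, Prod.mk.injEq] at e₁ e₂
  obtain ⟨rfl, e₁⟩ := e₁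
  obtain ⟨rfl, e₂⟩ := e₂
  have hpos {k : ℕ} {e : SSet.toTop.{u}.obj Δ[k]} (he : toTopSupportData.supp e = Set.univ)
      (r : Fin (k + 1)) : 0 < SimplexCategory.toTopHomeo ⦋k⦌ e r := by
    have : r ∈ toTopSupportData.supp e := by rw [he]; trivial
    exact lt_of_le_of_ne (by simp) (Ne.symm this)
  have key := coupling_unique σ.toOrderHom.monotone τ.toOrderHom.monotone σ'.toOrderHom.monotone
    τ'.toOrderHom.monotone (injective_of_nonDegenerate_prod σ τ a b hc)
    (injective_of_nonDegenerate_prod σ' τ' a b hc') (hpos hd) (hpos hd')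
    (fun i => by
      have := DFunLike.congr_fun (congrArg (SimplexCategory.toTopHomeo ⦋m⦌) e₁) i
      rwa [toTopHomeo_push_apply, toTopHomeo_push_apply] at this)
    (fun i => by
      have := DFunLike.congr_fun (congrArg (SimplexCategory.toTopHomeo ⦋l⦌) e₂) i
      rwa [toTopHomeo_push_apply, toTopHomeo_push_apply] at this)
  obtain rfl : n = n' := congrArg Sigma.fst key
  simp only [Sigma.mk.injEq, heq_eq_eq, true_and, Prod.mk.injEq] at key
  obtain ⟨k₁, k₂⟩ := key
  obtain rfl : σ = σ' := by
    ext r : 3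
    exact congrArg Prod.fst (congrFun k₁ r)
  obtain rfl : τ = τ' := by
    ext r : 3
    exact congrArg Prod.snd (congrFun k₁ r)
  obtain rfl : d = d' := by
    apply (SimplexCategory.toTopHomeo ⦋n⦌).injective
    ext r
    exact congrFun k₂ r
  rfl

end SSet

/-! ### Flags and their level functions -/

section Flags

variable {ι : Type*} [DecidableEq ι]

/-- The function `∑ r, t r • 1_{U r}` attached to a family of finite sets with weights. -/
def levelSum {k : ℕ} (U : Fin k → Finset ι) (t : Fin k → ℝ) (i : ι) : ℝ :=
  ∑ r with i ∈ U r, t r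

/-- The sum of the weights from a given index on. -/
def tailSum {k : ℕ} (t : Fin k → ℝ) (a : ℕ) : ℝ :=
  ∑ r : Fin k with a ≤ r.val, t r

lemma tailSum_succ {k : ℕ} (t : Fin k → ℝ) (r : Fin k) :
    tailSum t r = t r + tailSum t (r + 1) := by
  have : (Finset.univ.filter fun s : Fin k => r.val ≤ s.val) =
      insert r (Finset.univ.filter fun s : Fin k => r.val + 1 ≤ s.val) := by
    ext s
    simp only [Finset.mem_filter, Finset.mem_univ, true_and, Finset.mem_insert, Fin.ext_iff]
    lia
  rw [tailSum, this, Finset.sum_insert (by simp), tailSum]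

lemma tailSum_of_le {k : ℕ} (t : Fin k → ℝ) {a : ℕ} (ha : k ≤ a) : tailSum t a = 0 :=
  Finset.sum_eq_zero fun r hr => by
    have := (Finset.mem_filter.mp hr).2
    lia

lemma tailSum_injective {k : ℕ} {t t' : Fin k → ℝ}
    (h : ∀ r : Fin k, tailSum t r = tailSum t' r) : t = t' := by
  funext r
  have h₁ := tailSum_succ t r
  have h₂ := tailSum_succ t' r
  have h₃ : tailSum t (r + 1) = tailSum t' (r + 1) := by
    rcases lt_or_ge (r.val + 1) k with hr | hr
    · exact h ⟨r + 1, hr⟩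
    · rw [tailSum_of_le t hr, tailSum_of_le t' hr]
  linarith [h r]

lemma tailSum_nonneg {k : ℕ} {t : Fin k → ℝ} (ht : ∀ r, 0 ≤ t r) (a : ℕ) : 0 ≤ tailSum t a :=
  Finset.sum_nonneg fun _ _ => ht _

lemma tailSum_pos {k : ℕ} {t : Fin k → ℝ} (ht : ∀ r, 0 < t r) (r : Fin k) : 0 < tailSum t r :=
  tailSum_succ t r ▸ add_pos_of_pos_of_nonneg (ht r) (tailSum_nonneg (fun r => (ht r).le) _)

lemma tailSum_antitone {k : ℕ} {t : Fin k → ℝ} (ht : ∀ r, 0 ≤ t r) : Antitone (tailSum t) :=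
  fun _ _ hab => Finset.sum_le_sum_of_subset_of_nonneg
    (Finset.monotone_filter_right _ fun _ _ hr => hab.trans hr) fun _ _ _ => ht _

lemma tailSum_strictAnti {k : ℕ} {t : Fin k → ℝ} (ht : ∀ r, 0 < t r) :
    StrictAnti fun r : Fin k => tailSum t r := by
  intro a b hab
  have h₁ : tailSum t b ≤ tailSum t (a + 1) := tailSum_antitone (fun r => (ht r).le) hab
  have h₂ := tailSum_succ t a
  change tailSum t b < tailSum t a
  linarith [ht a]

variable {k : ℕ} {U : Fin k → Finset ι} {t : Fin k → ℝ}

lemma levelSum_nonneg (ht : ∀ r, 0 ≤ t r) (i : ι) : 0 ≤ levelSum U t i :=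
  Finset.sum_nonneg fun _ _ => ht _

lemma tailSum_le_levelSum (hU : Monotone U) (ht : ∀ r, 0 ≤ t r) {i : ι} {r : Fin k}
    (hi : i ∈ U r) : tailSum t r ≤ levelSum U t i :=
  Finset.sum_le_sum_of_subset_of_nonneg
    (Finset.monotone_filter_right _ fun _ _ hs => hU hs hi) fun _ _ _ => ht _

lemma levelSum_le_tailSum (ht : ∀ r, 0 ≤ t r) {i : ι} {a : ℕ}
    (hi : ∀ r : Fin k, i ∈ U r → a ≤ r) : levelSum U t i ≤ tailSum t a :=
  Finset.sum_le_sum_of_subset_of_nonneg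
    (Finset.monotone_filter_right _ fun s _ hs => hi s hs) fun _ _ _ => ht _

/-- The members of a flag are superlevel sets of its level function. -/
lemma mem_iff_tailSum_le_levelSum (hU : Monotone U) (ht : ∀ r, 0 < t r) {i : ι} {r : Fin k} :
    i ∈ U r ↔ tailSum t r ≤ levelSum U t i := by
  refine ⟨tailSum_le_levelSum hU fun r => (ht r).le, fun h => ?_⟩
  by_contra hi
  have h₁ : levelSum U t i ≤ tailSum t (r + 1) := levelSum_le_tailSum (fun r => (ht r).le)
    fun s hs => by
      by_contra hlt
      exact hi (hU (show s ≤ r by rw [Fin.le_def]; lia) hs)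
  linarith [tailSum_succ t r, ht r]

lemma exists_levelSum_eq_tailSum (hU : StrictMono U) (hne : ∀ r, (U r).Nonempty)
    (ht : ∀ r, 0 ≤ t r) (r : Fin k) : ∃ i, levelSum U t i = tailSum t r := by
  obtain ⟨i, hi, hlt⟩ : ∃ i ∈ U r, ∀ s < r, i ∉ U s := by
    rcases Nat.eq_zero_or_pos r.val with h0 | h0
    · obtain ⟨i, hi⟩ := hne r
      exact ⟨i, hi, fun s hs => by rw [Fin.lt_def] at hs; lia⟩
    · have hlt : (⟨r - 1, by lia⟩ : Fin k) < r := by rw [Fin.lt_def]; simp; lia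
      obtain ⟨i, hi, hi'⟩ := Finset.exists_of_ssubset (hU hlt)
      refine ⟨i, hi, fun s hs hs' => hi' (hU.monotone ?_ hs')⟩
      rw [Fin.lt_def] at hs
      rw [Fin.le_def]
      simp
      lia
  refine ⟨i, le_antisymm (levelSum_le_tailSum ht fun s hs => ?_)
    (tailSum_le_levelSum hU.monotone ht hi)⟩
  by_contra h
  exact hlt s (by rw [Fin.lt_def]; lia) hs

lemma exists_tailSum_eq_levelSum (hU : Monotone U) (ht : ∀ r, 0 ≤ t r) {i : ι}
    (hi : levelSum U t i ≠ 0) : ∃ r : Fin k, tailSum t r = levelSum U t i := by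
  obtain ⟨r₀, hr₀, -⟩ := Finset.exists_ne_zero_of_sum_ne_zero hi
  obtain ⟨r, hr, hmin⟩ := (Finset.univ.filter fun r => i ∈ U r).exists_minimal ⟨r₀, hr₀⟩
  refine ⟨r, le_antisymm (tailSum_le_levelSum hU ht (Finset.mem_filter.mp hr).2)
    (levelSum_le_tailSum ht fun s hs => ?_)⟩
  by_contra h
  exact h (hmin (by simpa using hs) (by rw [Fin.le_def]; lia))

/-- A strict flag of nonempty sets with positive weights is determined by its level function. -/
lemma flag_unique {k k' : ℕ} {U : Fin (k + 1) → Finset ι} {U' : Fin (k' + 1) → Finset ι}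
    {t : Fin (k + 1) → ℝ} {t' : Fin (k' + 1) → ℝ} (hU : StrictMono U) (hU' : StrictMono U')
    (hne : ∀ r, (U r).Nonempty) (hne' : ∀ r, (U' r).Nonempty) (ht : ∀ r, 0 < t r)
    (ht' : ∀ r, 0 < t' r) (h : levelSum U t = levelSum U' t') :
    (⟨k, U, t⟩ : Σ k : ℕ, (Fin (k + 1) → Finset ι) × (Fin (k + 1) → ℝ)) = ⟨k', U', t'⟩ := by
  have aux {k k' : ℕ} {U : Fin (k + 1) → Finset ι} {U' : Fin (k' + 1) → Finset ι}
    {t : Fin (k + 1) → ℝ} {t' : Fin (k' + 1) → ℝ} (hU : StrictMono U) (hU' : StrictMono U')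
    (hne : ∀ r, (U r).Nonempty) (ht : ∀ r, 0 < t r)
    (ht' : ∀ r, 0 < t' r) (h : levelSum U t = levelSum U' t') :
      Set.range (fun r : Fin (k + 1) => tailSum t r) ⊆
        Set.range (fun r : Fin (k' + 1) => tailSum t' r) := by
    rintro _ ⟨r, rfl⟩
    obtain ⟨i, hi⟩ := exists_levelSum_eq_tailSum hU hne (fun r => (ht r).le) r
    obtain ⟨s, hs⟩ := exists_tailSum_eq_levelSum (i := i) hU'.monotone (fun r => (ht' r).le)
      (by rw [← h, hi]; exact (tailSum_pos ht r).ne')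
    exact ⟨s, by simp only [hs, ← h, hi]⟩
  have hr := (aux hU hU' hne ht ht' h).antisymm (aux hU' hU hne' ht' ht h.symm)
  have hT := tailSum_strictAnti ht
  have hT' := tailSum_strictAnti ht'
  obtain rfl : k = k' := by
    have := congrArg Set.ncard hr
    rw [Set.ncard_range_of_injective hT.injective,
      Set.ncard_range_of_injective hT'.injective] at this
    simpa using this
  have hTT := (StrictAnti.range_inj hT hT').mp hr
  obtain rfl : t = t' := tailSum_injective (congrFun hTT)
  obtain rfl : U = U' := by
    funext r
    ext i
    rw [mem_iff_tailSum_le_levelSum hU.monotone ht, mem_iff_tailSum_le_levelSum hU'.monotone ht', h]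
  rfl

/-- Taking images of the members of a flag turns the level function into its fibrewise maximum. -/
lemma levelSum_image_le_iff {κ : Type*} [DecidableEq κ] (hU : Monotone U) (ht : ∀ r, 0 ≤ t r)
    {V : Fin k → Finset κ} (f : ι → κ) (hV : ∀ r j, j ∈ V r ↔ ∃ i ∈ U r, f i = j) (j : κ) {x : ℝ}
    (hx : 0 ≤ x) : levelSum V t j ≤ x ↔ ∀ i, f i = j → levelSum U t i ≤ x := by
  constructor
  · rintro h i rfl
    exact (Finset.sum_le_sum_of_subset_of_nonneg (Finset.monotone_filter_right _
      fun r _ hr => (hV r _).mpr ⟨i, hr, rfl⟩) fun _ _ _ => ht _).trans h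
  · intro h
    by_cases h0 : levelSum V t j = 0
    · rwa [h0]
    · obtain ⟨r₀, hr₀, -⟩ := Finset.exists_ne_zero_of_sum_ne_zero h0
      obtain ⟨r, hr, hmin⟩ := (Finset.univ.filter fun r => j ∈ V r).exists_minimal ⟨r₀, hr₀⟩
      obtain ⟨i, hi, rfl⟩ := (hV r j).mp (Finset.mem_filter.mp hr).2
      refine (levelSum_le_tailSum ht (a := r) fun s hs => ?_).trans
        ((tailSum_le_levelSum hU ht hi).trans (h i rfl))
      by_contra hlt
      exact hlt (hmin (by simpa using hs) (by rw [Fin.le_def]; lia))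

/-- Every function with values in `[0, 1]` and maximum `1` is the level function of a flag: order
the points by decreasing value, take the initial segments, and weight these by the successive
differences of the values. -/
lemma exists_flag {n : ℕ} (h : Fin (n + 1) → ℝ) (h0 : ∀ i, 0 ≤ h i) (h1 : ∀ i, h i ≤ 1)
    (hmax : ∃ i, h i = 1) :
    ∃ (U : Fin (n + 1) → Finset (Fin (n + 1))) (t : Fin (n + 1) → ℝ), Monotone U ∧
      (∀ r, (U r).Nonempty) ∧ (∀ r, 0 ≤ t r) ∧ ∑ r, t r = 1 ∧ levelSum U t = h := by
  obtain ⟨σ, hσ⟩ : ∃ σ : Equiv.Perm (Fin (n + 1)), Antitone (h ∘ σ) :=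
    ⟨_, fun _ _ hab => Tuple.monotone_sort (fun i => OrderDual.toDual (h i)) hab⟩
  -- the values in decreasing order, continued by zero
  let G (a : ℕ) : ℝ := if ha : a < n + 1 then h (σ ⟨a, ha⟩) else 0
  let t (r : Fin (n + 1)) : ℝ := G r - G (r + 1)
  have hG (r : Fin (n + 1)) : G r = h (σ r) := dif_pos r.isLt
  have ht (r : Fin (n + 1)) : 0 ≤ t r := by
    simp only [t, hG, G]
    split_ifs with hr
    · exact sub_nonneg.mpr (hσ (show r ≤ ⟨r + 1, hr⟩ by rw [Fin.le_def]; simp))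
    · simpa using h0 _
  have htail (a : ℕ) : tailSum t a = G a := by
    rcases lt_or_ge a (n + 1) with ha | ha
    · induction hd : n + 1 - a generalizing a with
      | zero => lia
      | succ d ih =>
        have := tailSum_succ t ⟨a, ha⟩
        simp only [t] at this
        rcases lt_or_ge (a + 1) (n + 1) with ha' | ha'
        · rw [this, ih (a + 1) ha' (by lia)]
          ring
        · rw [this, tailSum_of_le _ ha', show G (a + 1) = 0 from dif_neg ha'.not_gt]
          ring
    · rw [tailSum_of_le t ha, show G a = 0 from dif_neg ha.not_gt]
  refine ⟨fun r => Finset.univ.filter fun i => σ.symm i ≤ r, t, ?_, ?_, ht, ?_, ?_⟩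
  · exact fun a b hab => Finset.monotone_filter_right _ fun _ _ hi => hi.trans hab
  · exact fun r => ⟨σ r, by simp⟩
  · have e : ∑ r, t r = tailSum t 0 := by simp [tailSum]
    obtain ⟨i, hi⟩ := hmax
    have hle : h i ≤ h (σ 0) := by
      simpa using hσ (Fin.zero_le (σ.symm i))
    rw [e, htail]
    exact (hG 0).trans (le_antisymm (h1 _) (hi ▸ hle))
  · funext i
    rw [← σ.apply_symm_apply i, ← hG, ← htail]
    refine Finset.sum_congr ?_ fun _ _ => rfl
    ext r
    simp only [Finset.mem_filter, Finset.mem_univ, true_and, Equiv.symm_apply_apply, Fin.le_def]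

end Flags

/-! ### Pushing functions forward by maxima -/

/-- The pushforward of a function by taking maxima over the fibres of a map. -/
noncomputable def maxPush {α β : Type*} [Fintype α] [DecidableEq β] (f : α → β) (h : α → ℝ≥0)
    (j : β) : ℝ≥0 :=
  (Finset.univ.filter fun i => f i = j).sup h

section maxPush

variable {α β γ : Type*} [Fintype α] [DecidableEq β] {f : α → β} {h : α → ℝ≥0}

lemma maxPush_le_iff {j : β} {x : ℝ≥0} : maxPush f h j ≤ x ↔ ∀ i, f i = j → h i ≤ x := by
  simp [maxPush]

lemma le_maxPush (i : α) : h i ≤ maxPush f h (f i) :=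
  maxPush_le_iff.mp le_rfl i rfl

lemma lt_maxPush_iff {j : β} {x : ℝ≥0} : x < maxPush f h j ↔ ∃ i, f i = j ∧ x < h i := by
  rw [← not_le, maxPush_le_iff]
  push Not
  rfl

lemma maxPush_ne_zero_iff {j : β} : maxPush f h j ≠ 0 ↔ ∃ i, f i = j ∧ h i ≠ 0 := by
  simp_rw [← pos_iff_ne_zero]
  exact lt_maxPush_iff

lemma exists_eq_maxPush {j : β} (hj : maxPush f h j ≠ 0) : ∃ i, f i = j ∧ h i = maxPush f h j := by
  obtain ⟨i₀, hi₀, -⟩ := maxPush_ne_zero_iff.mp hj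
  obtain ⟨i, hi, h'⟩ := Finset.exists_mem_eq_sup (Finset.univ.filter fun i => f i = j)
    ⟨i₀, by simpa using hi₀⟩ h
  exact ⟨i, (Finset.mem_filter.mp hi).2, h'.symm⟩

lemma maxPush_comp [Fintype β] [DecidableEq γ] (g : β → γ) :
    maxPush (g ∘ f) h = maxPush g (maxPush f h) := by
  funext j
  refine eq_of_forall_ge_iff fun x => ?_
  simp only [maxPush_le_iff, Function.comp_apply]
  exact ⟨fun H b hb i hi => H i (hi ▸ hb), fun H i hi => H _ hi i rfl⟩

lemma maxPush_apply_of_injective (hf : Function.Injective f) (i : α) :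
    maxPush f h (f i) = h i :=
  le_antisymm (maxPush_le_iff.mpr fun _ hi' => (congrArg h (hf hi')).le) (le_maxPush i)

lemma maxPush_eq_iff {π : α → β} {f : α → ℝ≥0} {h : β → ℝ≥0} : maxPush π f = h ↔
      (∀ d, f d ≤ h (π d)) ∧ ∀ c, h c ≠ 0 → ∃ d, π d = c ∧ h c ≤ f d := by
  constructor
  · rintro rfl
    exact ⟨fun d => le_maxPush d, fun c hc => (exists_eq_maxPush hc).imp fun d hd =>
      ⟨hd.1, hd.2.ge⟩⟩
  · rintro ⟨h₁, h₂⟩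
    funext c
    refine le_antisymm (maxPush_le_iff.mpr fun d hd => hd ▸ h₁ d) ?_
    obtain hc | hc := eq_or_ne (h c) 0
    · exact hc.trans_le zero_le
    · obtain ⟨d, rfl, hd⟩ := h₂ c hc
      exact hd.trans (le_maxPush d)

lemma continuous_maxPush (f : α → β) : Continuous (maxPush f) := by
  refine continuous_pi fun j => ?_
  exact Continuous.finset_sup_apply fun i _ => continuous_apply i

lemma maxPush_comp_of_ne_zero_subset_range {f : α → β} (hf : Function.Injective f)
    {h : β → ℝ≥0} (hr : ∀ j, h j ≠ 0 → j ∈ Set.range f) :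
    maxPush f (h ∘ f) = h := by
  funext j
  by_cases hj : h j = 0
  · rw [hj]
    by_contra hne
    obtain ⟨i, rfl, hi⟩ := maxPush_ne_zero_iff.mp hne
    exact hi hj
  · obtain ⟨i, rfl⟩ := hr j hj
    exact maxPush_apply_of_injective hf i

end maxPush

/-! ### Coordinates on the realization of the poset of nonempty subsets -/

namespace SSet

section

variable {n : SimplexCategory}

/-- A simplex of the nerve `SimplexCategory.sd.obj n` of the poset of nonempty subsets of `{0, …,
n}`, as a functor to this poset. The latter is encoded as the poset of nonempty finite chains of the
linear order `{0, …, n}`. -/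
def flagFunctor {k : SimplexCategory} (U : (SimplexCategory.sd.{u}.obj n).obj (op k)) :
    Fin (k.len + 1) ⥤ PartialOrder.NonemptyFiniteChains (ULift.{u} (Fin (n.len + 1))) := U

/-- The flag of subsets of `{0, …, n}` which makes up a simplex of the subdivision of `Δ[n]`. -/
def flagSet {k : SimplexCategory} (U : (SimplexCategory.sd.{u}.obj n).obj (op k))
    (r : Fin (k.len + 1)) : Finset (ULift.{u} (Fin (n.len + 1))) :=
  ((flagFunctor U).obj r).finset

lemma flagSet_monotone {k : SimplexCategory} (U : (SimplexCategory.sd.{u}.obj n).obj (op k)) :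
    Monotone (flagSet U) :=
  fun _ _ hab => (flagFunctor U).monotone hab

lemma flagSet_nonempty {k : SimplexCategory} (U : (SimplexCategory.sd.{u}.obj n).obj (op k))
    (r : Fin (k.len + 1)) : (flagSet U r).Nonempty :=
  ((flagFunctor U).obj r).nonempty

lemma mem_flagSet_app {k m : SimplexCategory} (θ : n ⟶ m)
    (U : (SimplexCategory.sd.{u}.obj n).obj (op k)) (r : Fin (k.len + 1)) (j) :
    j ∈ flagSet ((SimplexCategory.sd.map θ).app (op k) U) r ↔
      ∃ i ∈ flagSet U r, ULift.up (θ.toOrderHom i.down) = j := by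
  exact PartialOrder.NonemptyFiniteChains.mem_map_iff _ _ _

lemma flagSet_injective {k : SimplexCategory} :
    Function.Injective (flagSet (n := n) (k := k)) := by
  intro U U' h
  have : flagFunctor U = flagFunctor U' := CategoryTheory.Functor.ext
    (fun r => PartialOrder.NonemptyFiniteChains.ext (by exact congrFun h r))
    (fun _ _ _ => Subsingleton.elim _ _)
  exact this

lemma flagSet_strictMono {k : ℕ} {U : (SimplexCategory.sd.{u}.obj n).obj (op ⦋k⦌)}
    (hU : U ∈ (SimplexCategory.sd.{u}.obj n).nonDegenerate k) : StrictMono (flagSet U) :=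
  (PartialOrder.mem_nerve_nonDegenerate_iff_strictMono
    (X := PartialOrder.NonemptyFiniteChains (ULift.{u} (Fin (n.len + 1)))) U).mp hU

lemma exists_flagSet_eq {k : SimplexCategory}
    (V : Fin (k.len + 1) → Finset (ULift.{u} (Fin (n.len + 1)))) (hV : Monotone V)
    (hne : ∀ r, (V r).Nonempty) :
    ∃ U : (SimplexCategory.sd.{u}.obj n).obj (op k), flagSet U = V := by
  let F : Fin (k.len + 1) →o PartialOrder.NonemptyFiniteChains (ULift.{u} (Fin (n.len + 1))) :=
    ⟨fun r => ⟨V r, hne r, fun a b => le_total a b⟩, fun _ _ hab => hV hab⟩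
  exact ⟨F.monotone.functor, rfl⟩

/-- The barycentric coordinates of a point of the realization of `Δ[k]`. -/
noncomputable abbrev bary {k : SimplexCategory}
    (d : SSet.toTop.{u}.obj (SSet.stdSimplex.obj k)) (r : Fin (k.len + 1)) : ℝ :=
  k.toTopHomeo d r

lemma levelSum_push {k l : SimplexCategory} {ι : Type*} [DecidableEq ι] (θ : k ⟶ l)
    (U : Fin (l.len + 1) → Finset ι) (d : SSet.toTop.{u}.obj (SSet.stdSimplex.obj k)) :
    levelSum U (bary (push SSet.toTop θ d)) =
      levelSum (fun r => U (θ.toOrderHom r)) (bary d) := by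
  funext i
  simp only [levelSum, bary, toTopHomeo_push_apply]
  rw [← Finset.sum_fiberwise_of_maps_to (s := Finset.univ.filter fun r => i ∈ U (θ.toOrderHom r))
    (t := Finset.univ.filter fun r => i ∈ U r) (g := θ.toOrderHom) (by simp)]
  refine Finset.sum_congr rfl fun q hq => Finset.sum_congr ?_ fun _ _ => rfl
  ext r
  simp only [Finset.mem_filter, Finset.mem_univ, true_and] at hq ⊢
  grind

variable (n) in
lemma exists_flagCoord : ∃ c : SSet.toTop.obj (SimplexCategory.sd.{u}.obj n) →
    (Fin (n.len + 1) → ℝ≥0), Continuous c ∧ ∀ (k : SimplexCategory)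
      (U : (SimplexCategory.sd.{u}.obj n).obj (op k)) d i,
      (c (cell SSet.toTop U d) i : ℝ) = levelSum (flagSet U) (bary d) ⟨i⟩ := by
  obtain ⟨c, hc, h⟩ := exists_desc_small SSet.toTop.{u} (X := SimplexCategory.sd.{u}.obj n)
    (T := Fin (n.len + 1) → ℝ≥0)
    (fun k U d i => ⟨levelSum (flagSet U) (bary d) ⟨i⟩, levelSum_nonneg (fun r => by simp) _⟩)
    (fun k U => continuous_pi fun i => Continuous.subtype_mk (continuous_finsetSum _ fun r _ =>
      (continuous_apply r).comp (continuous_subtype_val.comp k.toTopHomeo.continuous)) _)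
    (fun k l θ U d => by
      funext i
      apply NNReal.eq
      change levelSum _ _ _ = levelSum _ _ _
      rw [levelSum_push]
      rfl)
  exact ⟨c, hc, fun k U d i => by rw [h]; rfl⟩

variable (n) in
/-- The coordinates on the realization of the poset of nonempty subsets of `{0, …, n}`: the point
`∑ r, t r • U r` has coordinates `∑ r, t r • 1_{U r}`. -/
noncomputable def flagCoord : SSet.toTop.obj (SimplexCategory.sd.{u}.obj n) →
    (Fin (n.len + 1) → ℝ≥0) := (exists_flagCoord n).choose

lemma continuous_flagCoord : Continuous (flagCoord.{u} n) := (exists_flagCoord n).choose_spec.1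

lemma flagCoord_cell {k : SimplexCategory} (U : (SimplexCategory.sd.{u}.obj n).obj (op k)) (d)
    (i : Fin (n.len + 1)) :
    (flagCoord n (cell SSet.toTop U d) i : ℝ) = levelSum (flagSet U) (bary d) ⟨i⟩ :=
  (exists_flagCoord n).choose_spec.2 k U d i

/-- A point is recovered from its coordinates, as the flag is given by their superlevel sets. -/
lemma flagCoord_injective : Function.Injective (flagCoord.{u} n) := by
  intro p p' h
  obtain ⟨k, U, d, hU, hd, rfl⟩ := toTopSupportData.exists_normalForm p
  obtain ⟨k', U', d', hU', hd', rfl⟩ := toTopSupportData.exists_normalForm p'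
  have hpos {k : ℕ} {e : SSet.toTop.{u}.obj Δ[k]} (he : toTopSupportData.supp e = Set.univ)
      (r : Fin (k + 1)) : 0 < bary e r := by
    have : r ∈ toTopSupportData.supp e := by rw [he]; trivial
    exact lt_of_le_of_ne (by simp) (Ne.symm this)
  have key := flag_unique (flagSet_strictMono hU) (flagSet_strictMono hU') (flagSet_nonempty U)
    (flagSet_nonempty U') (hpos hd) (hpos hd') (by
      funext i
      exact (flagCoord_cell U d i.down).symm.trans
        ((congrArg NNReal.toReal (congrFun h i.down)).trans (flagCoord_cell U' d' i.down)))
  obtain rfl : k = k' := congrArg Sigma.fst key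
  simp only [Sigma.mk.injEq, heq_eq_eq, true_and, Prod.mk.injEq] at key
  obtain rfl := flagSet_injective key.1
  obtain rfl : d = d' := by
    apply (SimplexCategory.toTopHomeo ⦋k⦌).injective
    ext r
    exact congrFun key.2 r
  rfl

lemma flagCoord_le_one (p : SSet.toTop.obj (SimplexCategory.sd.{u}.obj n)) (i) :
    flagCoord n p i ≤ 1 := by
  obtain ⟨k, U, d, rfl⟩ := exists_cell SSet.toTop p
  rw [← NNReal.coe_le_coe, flagCoord_cell U d]
  calc levelSum (flagSet U) (bary d) ⟨i⟩ ≤ ∑ r, bary d r :=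
        Finset.sum_le_sum_of_subset_of_nonneg (Finset.subset_univ _) fun _ _ _ => by simp
    _ = 1 := _root_.stdSimplex.sum_eq_one _

lemma exists_flagCoord_eq_one (p : SSet.toTop.obj (SimplexCategory.sd.{u}.obj n)) :
    ∃ i, flagCoord n p i = 1 := by
  obtain ⟨k, U, d, rfl⟩ := exists_cell SSet.toTop p
  obtain ⟨i, hi⟩ := flagSet_nonempty U 0
  refine ⟨i.down, NNReal.eq ?_⟩
  rw [flagCoord_cell U d, levelSum, Finset.filter_true_of_mem]
  · exact _root_.stdSimplex.sum_eq_one _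
  · exact fun r _ => flagSet_monotone U (Fin.zero_le r) hi

lemma exists_flagCoord_eq (h : Fin (n.len + 1) → ℝ≥0) (h1 : ∀ i, h i ≤ 1) (hmax : ∃ i, h i = 1) :
    ∃ p, flagCoord.{u} n p = h := by
  obtain ⟨U, t, hU, hne, ht, hsum, hlev⟩ := exists_flag (fun i => (h i : ℝ)) (fun i => (h i).2)
    (fun i => by exact_mod_cast h1 i) (hmax.imp fun i hi => by simp [hi])
  obtain ⟨V, hV⟩ := exists_flagSet_eq.{u} (n := n) (k := n)
    (fun r => (U r).map Equiv.ulift.symm.toEmbedding)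
    (fun a b hab => Finset.map_subset_map.mpr (hU hab)) (fun r => (hne r).map)
  refine ⟨cell SSet.toTop V (n.toTopHomeo.symm ⟨t, ht, hsum⟩), ?_⟩
  funext i
  apply NNReal.eq
  have hb : bary (n.toTopHomeo.symm ⟨t, ht, hsum⟩) = t :=
    congrArg DFunLike.coe (n.toTopHomeo.apply_symm_apply ⟨t, ht, hsum⟩)
  rw [flagCoord_cell, hV, ← congrFun hlev i, hb]
  refine Finset.sum_congr ?_ fun _ _ => rfl
  ext r
  simp [Equiv.ulift]

lemma flagCoord_map {m : SimplexCategory} (θ : n ⟶ m)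
    (p : SSet.toTop.obj (SimplexCategory.sd.{u}.obj n)) :
    flagCoord m (SSet.toTop.map (SimplexCategory.sd.map θ) p) =
      maxPush θ.toOrderHom (flagCoord n p) := by
  obtain ⟨k, U, d, rfl⟩ := exists_cell SSet.toTop p
  funext j
  refine eq_of_forall_ge_iff fun x => ?_
  rw [map_cell, maxPush_le_iff, ← NNReal.coe_le_coe, flagCoord_cell]
  refine (levelSum_image_le_iff (flagSet_monotone U) (fun r => by simp)
      (fun i => ULift.up (θ.toOrderHom i.down)) (mem_flagSet_app θ U) _ x.2).trans ?_
  constructor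
  · rintro H i rfl
    rw [← NNReal.coe_le_coe, flagCoord_cell]
    exact H ⟨i⟩ rfl
  · intro H i hi
    have := H i.down (congrArg ULift.down hi)
    rwa [← NNReal.coe_le_coe, flagCoord_cell] at this

end

end SSet

/-! ### Coordinates on subdivisions of simplices and of their products -/

namespace SSet

/-- The functor `X ↦ |Sd X|`. -/
noncomputable abbrev sdTop : SSet.{u} ⥤ TopCat.{u} := sd ⋙ SSet.toTop

section

variable {n : SimplexCategory}

/-- The coordinates on `|Sd Δ[n]|`, which identify it with the space of functions
`{0, …, n} → [0, 1]` whose maximum is `1`. -/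
noncomputable def sdCoord (d : sdTop.{u}.obj (SSet.stdSimplex.obj n)) : Fin (n.len + 1) → ℝ≥0 :=
  flagCoord n (SSet.toTop.map (stdSimplex.sdIso.hom.app n) d)

lemma continuous_sdCoord : Continuous (sdCoord.{u} (n := n)) :=
  continuous_flagCoord.comp (SSet.toTop.map (stdSimplex.sdIso.hom.app n)).hom.continuous

lemma toTop_map_sdIso_bijective :
    Function.Bijective (SSet.toTop.map (stdSimplex.sdIso.{u}.hom.app n)) :=
  ConcreteCategory.bijective_of_isIso (SSet.toTop.map (stdSimplex.sdIso.{u}.hom.app n))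

lemma sdCoord_injective : Function.Injective (sdCoord.{u} (n := n)) :=
  flagCoord_injective.comp toTop_map_sdIso_bijective.1

lemma sdCoord_le_one (d : sdTop.{u}.obj (SSet.stdSimplex.obj n)) (i) : sdCoord d i ≤ 1 :=
  flagCoord_le_one _ i

lemma exists_sdCoord_eq_one (d : sdTop.{u}.obj (SSet.stdSimplex.obj n)) : ∃ i, sdCoord d i = 1 :=
  exists_flagCoord_eq_one _

lemma exists_sdCoord_eq (h : Fin (n.len + 1) → ℝ≥0) (h1 : ∀ i, h i ≤ 1) (hmax : ∃ i, h i = 1) :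
    ∃ d : sdTop.{u}.obj (SSet.stdSimplex.obj n), sdCoord d = h := by
  obtain ⟨p, hp⟩ := exists_flagCoord_eq h h1 hmax
  obtain ⟨d, rfl⟩ := toTop_map_sdIso_bijective.2 p
  exact ⟨d, hp⟩

lemma sdCoord_push {m : SimplexCategory} (θ : n ⟶ m) (d : sdTop.{u}.obj (SSet.stdSimplex.obj n)) :
    sdCoord (push sdTop θ d) = maxPush θ.toOrderHom (sdCoord d) := by
  rw [sdCoord, sdCoord, ← flagCoord_map]
  congr 1
  exact ConcreteCategory.congr_hom
    (((Functor.whiskerRight stdSimplex.sdIso.{u}.hom SSet.toTop).naturality θ)) d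

/-- The support of a point of `|Sd Δ[n]|` is the set of vertices at which its coordinates are
nonzero. -/
noncomputable def sdSupportData : SupportData sdTop.{u} where
  supp {n} d := {i | sdCoord d i ≠ 0}
  supp_push {m n} θ d := by
    ext j
    simp only [Set.mem_ofPred_eq, Set.mem_image]
    rw [sdCoord_push, maxPush_ne_zero_iff]
    exact exists_congr fun i => and_comm
  exists_full {n} d := by
    classical
    obtain ⟨i₀, hi₀⟩ := exists_sdCoord_eq_one d
    obtain ⟨k, ι, hι, hr⟩ := SimplexCategory.exists_mono_of_finset
      (Finset.univ.filter fun i => sdCoord d i ≠ 0) ⟨i₀, by simp [hi₀]⟩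
    have hr' (i) : i ∈ Set.range ι.toOrderHom ↔ sdCoord d i ≠ 0 := by simp [hr]
    obtain ⟨r₀, rfl⟩ := (hr' i₀).mpr (by simp [hi₀])
    obtain ⟨d₀, hd₀⟩ := exists_sdCoord_eq.{u} (n := ⦋k⦌) (sdCoord d ∘ ι.toOrderHom)
      (fun i => sdCoord_le_one d _) ⟨r₀, hi₀⟩
    refine ⟨k, ι, d₀, hι, ?_, sdCoord_injective ?_⟩
    · ext r
      simp only [Set.mem_ofPred_eq, Set.mem_univ, iff_true, hd₀]
      exact (hr' _).mp ⟨r, rfl⟩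
    · rw [sdCoord_push, hd₀]
      exact maxPush_comp_of_ne_zero_subset_range (SimplexCategory.mono_iff_injective.mp hι)
        fun j hj => (hr' j).mpr hj

end

section

variable {m n : ℕ}

/-- The map `r ↦ (α r, β r)` which corresponds to a simplex `(α, β)` of `Δ[m] × Δ[n]`. -/
def vertexMap {k : SimplexCategory} (z : (Δ[m] ⊗ Δ[n] : SSet.{u}).obj (op k))
    (r : Fin (k.len + 1)) : Fin (m + 1) × Fin (n + 1) :=
  ((stdSimplex.objEquiv z.1).toOrderHom r, (stdSimplex.objEquiv z.2).toOrderHom r)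

lemma vertexMap_strictMono {k : ℕ} {z : (Δ[m] ⊗ Δ[n] : SSet.{u}) _⦋k⦌}
    (hz : z ∈ (Δ[m] ⊗ Δ[n] : SSet.{u}).nonDegenerate k) : StrictMono (vertexMap z) :=
  (prodStdSimplex.nonDegenerate_iff_strictMono_objEquiv z).mp hz

lemma vertexMap_monotone {k : SimplexCategory} (z : (Δ[m] ⊗ Δ[n] : SSet.{u}).obj (op k)) :
    Monotone (vertexMap z) := fun _ _ h =>
  ⟨(stdSimplex.objEquiv z.1).toOrderHom.monotone h, (stdSimplex.objEquiv z.2).toOrderHom.monotone h⟩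

lemma vertexMap_injective {k : SimplexCategory} :
    Function.Injective (vertexMap.{u} (m := m) (n := n) (k := k)) := by
  intro z z' h
  apply Prod.ext
  · apply stdSimplex.objEquiv.injective
    ext r : 3
    exact congrArg Prod.fst (congrFun h r)
  · apply stdSimplex.objEquiv.injective
    ext r : 3
    exact congrArg Prod.snd (congrFun h r)

variable (m n) in
lemma exists_prodCoord : ∃ M : sdTop.{u}.obj (Δ[m] ⊗ Δ[n]) → (Fin (m + 1) × Fin (n + 1) → ℝ≥0),
    Continuous M ∧ ∀ (k : SimplexCategory) (z : (Δ[m] ⊗ Δ[n] : SSet.{u}).obj (op k)) d,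
      M (cell sdTop z d) = maxPush (vertexMap z) (sdCoord d) :=
  exists_desc_small sdTop (fun k z d => maxPush (vertexMap z) (sdCoord d))
    (fun k z => (continuous_maxPush _).comp continuous_sdCoord)
    (fun k l θ z d => by
      rw [sdCoord_push, ← maxPush_comp]
      rfl)

variable (m n) in
/-- The coordinates on `|Sd (Δ[m] × Δ[n])|`, which identify it with the space of matrices with
entries in `[0, 1]` and maximal entry `1` whose nonzero entries form a chain: the entries at the
vertices of a simplex are the coordinates in the subdivision of that simplex, and all others
vanish. -/
noncomputable def prodCoord : sdTop.{u}.obj (Δ[m] ⊗ Δ[n]) → (Fin (m + 1) × Fin (n + 1) → ℝ≥0) :=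
  (exists_prodCoord m n).choose

lemma continuous_prodCoord : Continuous (prodCoord.{u} m n) :=
  (exists_prodCoord m n).choose_spec.1

lemma prodCoord_cell {k : SimplexCategory} (z : (Δ[m] ⊗ Δ[n] : SSet.{u}).obj (op k)) (d) :
    prodCoord m n (cell sdTop z d) = maxPush (vertexMap z) (sdCoord d) :=
  (exists_prodCoord m n).choose_spec.2 k z d

lemma prodCoord_injective : Function.Injective (prodCoord.{u} m n) := by
  intro p p' h
  obtain ⟨k, z, d, hz, hd, rfl⟩ := sdSupportData.exists_normalForm p
  obtain ⟨k', z', d', hz', hd', rfl⟩ := sdSupportData.exists_normalForm p'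
  rw [prodCoord_cell (k := ⦋k⦌), prodCoord_cell (k := ⦋k'⦌)] at h
  have hne {k : ℕ} {e : sdTop.{u}.obj Δ[k]} (he : sdSupportData.supp e = Set.univ)
      (r : Fin (k + 1)) : (sdCoord e r : ℝ) ≠ 0 := by
    have : r ∈ sdSupportData.supp e := by rw [he]; trivial
    exact NNReal.coe_ne_zero.mpr this
  have hm := vertexMap_strictMono hz
  have hm' := vertexMap_strictMono hz'
  have key := weightedChain_unique (W := fun p => (maxPush (vertexMap z) (sdCoord d) p : ℝ))
    (t := fun r => (sdCoord d r : ℝ)) (t' := fun r => (sdCoord d' r : ℝ)) hm hm'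
    (hne hd) (hne hd') (fun r => congrArg _ (maxPush_apply_of_injective hm.injective r))
    (fun r => by rw [h]; exact congrArg _ (maxPush_apply_of_injective hm'.injective r))
    (fun p hp => by
      obtain ⟨r, hr, -⟩ := maxPush_ne_zero_iff.mp (NNReal.coe_ne_zero.mp hp)
      exact ⟨r, hr⟩)
    (fun p hp => by
      rw [h] at hp
      obtain ⟨r, hr, -⟩ := maxPush_ne_zero_iff.mp (NNReal.coe_ne_zero.mp hp)
      exact ⟨r, hr⟩)
  obtain rfl : k = k' := congrArg Sigma.fst key
  simp only [Sigma.mk.injEq, heq_eq_eq, true_and, Prod.mk.injEq] at key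
  obtain rfl := vertexMap_injective key.1
  obtain rfl : d = d' := sdCoord_injective (funext fun r => NNReal.eq (congrFun key.2 r))
  rfl

lemma prodCoord_chain (p : sdTop.{u}.obj (Δ[m] ⊗ Δ[n])) {a b : Fin (m + 1) × Fin (n + 1)}
    (ha : prodCoord m n p a ≠ 0) (hb : prodCoord m n p b ≠ 0) : a ≤ b ∨ b ≤ a := by
  obtain ⟨k, z, d, rfl⟩ := exists_cell sdTop p
  rw [prodCoord_cell (k := ⦋k⦌)] at ha hb
  obtain ⟨r, rfl, -⟩ := maxPush_ne_zero_iff.mp ha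
  obtain ⟨s, rfl, -⟩ := maxPush_ne_zero_iff.mp hb
  exact (le_total r s).imp (fun h => vertexMap_monotone z h) (fun h => vertexMap_monotone z h)

lemma exists_prodCoord_eq (f : Fin (m + 1) × Fin (n + 1) → ℝ≥0) (h1 : ∀ a, f a ≤ 1)
    (hmax : ∃ a, f a = 1) (hch : ∀ a b, f a ≠ 0 → f b ≠ 0 → a ≤ b ∨ b ≤ a) :
    ∃ p, prodCoord.{u} m n p = f := by
  classical
  obtain ⟨a₀, ha₀⟩ := hmax
  let S : Finset (Fin (m + 1) ×ₗ Fin (n + 1)) := Finset.univ.filter fun a => f (ofLex a) ≠ 0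
  have hS : S.Nonempty := ⟨toLex a₀, by simp [S, ha₀]⟩
  obtain ⟨k, hk⟩ : ∃ k, S.card = k + 1 := ⟨_, (Nat.succ_pred_eq_of_pos hS.card_pos).symm⟩
  let e : Fin (k + 1) → Fin (m + 1) × Fin (n + 1) := fun r => ofLex (S.orderEmbOfFin hk r)
  have he (r : Fin (k + 1)) : f (e r) ≠ 0 :=
    (Finset.mem_filter.mp (S.orderEmbOfFin_mem hk r)).2
  have hinj : Function.Injective e := ofLex.injective.comp (S.orderEmbOfFin hk).injective
  have hrange (a) (ha : f a ≠ 0) : a ∈ Set.range e := by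
    have : toLex a ∈ Set.range (S.orderEmbOfFin hk) := by
      rw [S.range_orderEmbOfFin hk]
      simpa [S] using ha
    obtain ⟨r, hr⟩ := this
    exact ⟨r, congrArg ofLex hr⟩
  -- On a chain, the lexicographic order agrees with the product order.
  have hmono : Monotone e := fun r s hrs => by
    rcases hch _ _ (he r) (he s) with h | h
    · exact h
    · have h' : toLex (e s) ≤ toLex (e r) := Prod.Lex.toLex_mono h
      exact (congrArg ofLex (le_antisymm ((S.orderEmbOfFin hk).monotone hrs) h')).le
  let α : ⦋k⦌ ⟶ ⦋m⦌ := SimplexCategory.Hom.mk ⟨fun r => (e r).1, fun _ _ h => (hmono h).1⟩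
  let β : ⦋k⦌ ⟶ ⦋n⦌ := SimplexCategory.Hom.mk ⟨fun r => (e r).2, fun _ _ h => (hmono h).2⟩
  let z : (Δ[m] ⊗ Δ[n] : SSet.{u}).obj (op ⦋k⦌) :=
    (stdSimplex.objEquiv.symm α, stdSimplex.objEquiv.symm β)
  obtain ⟨r₀, hr₀⟩ := hrange a₀ (by simp [ha₀])
  obtain ⟨d, hd⟩ := exists_sdCoord_eq.{u} (n := ⦋k⦌) (f ∘ e) (fun r => h1 _)
    ⟨r₀, by simp [hr₀, ha₀]⟩
  refine ⟨cell sdTop z d, ?_⟩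
  rw [prodCoord_cell, hd]
  exact maxPush_comp_of_ne_zero_subset_range hinj hrange

lemma sdCoord_map_fst (p : sdTop.{u}.obj (Δ[m] ⊗ Δ[n])) :
    sdCoord (sdTop.map (CartesianMonoidalCategory.fst Δ[m] Δ[n]) p) =
      maxPush Prod.fst (prodCoord m n p) := by
  obtain ⟨k, z, d, rfl⟩ := exists_cell sdTop p
  rw [prodCoord_cell (k := ⦋k⦌), ← maxPush_comp]
  refine Eq.trans ?_ (sdCoord_push (stdSimplex.objEquiv z.1) d)
  exact congrArg sdCoord (map_cell sdTop (n := ⦋k⦌) z _ d)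

lemma sdCoord_map_snd (p : sdTop.{u}.obj (Δ[m] ⊗ Δ[n])) :
    sdCoord (sdTop.map (CartesianMonoidalCategory.snd Δ[m] Δ[n]) p) =
      maxPush Prod.snd (prodCoord m n p) := by
  obtain ⟨k, z, d, rfl⟩ := exists_cell sdTop p
  rw [prodCoord_cell (k := ⦋k⦌), ← maxPush_comp]
  refine Eq.trans ?_ (sdCoord_push (stdSimplex.objEquiv z.2) d)
  exact congrArg sdCoord (map_cell sdTop (n := ⦋k⦌) z _ d)

end

end SSet

/-! ### Absolute extensors -/

/-- A subset `s` of a topological space is an absolute extensor (for metric spaces) if every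
continuous map into `s` from a closed subset of a metric space extends to the whole space.
The metric spaces range over the universe of `E`. Maps on the closed subset are encoded as total
functions which are only constrained there. -/
def IsAbsoluteExtensor {E : Type u} [TopologicalSpace E] (s : Set E) : Prop :=
  ∀ (Z : Type u) [MetricSpace Z] (C : Set Z) (f : Z → E), IsClosed C → ContinuousOn f C →
    Set.MapsTo f C s → ∃ g : Z → E, Continuous g ∧ (∀ z, g z ∈ s) ∧ Set.EqOn g f C

namespace IsAbsoluteExtensor

variable {E : Type u} [TopologicalSpace E] {s A B : Set E}

lemma singleton (x : E) : IsAbsoluteExtensor ({x} : Set E) :=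
  fun _ _ _ _ _ _ hf => ⟨fun _ => x, continuous_const, fun _ => rfl, fun _ hz => (hf hz).symm⟩

lemma nonempty [Nonempty E] (hs : IsAbsoluteExtensor s) : s.Nonempty := by
  obtain ⟨g, -, hg, -⟩ := hs PUnit ∅ (fun _ => Classical.arbitrary E) isClosed_empty
    (continuousOn_empty _) (Set.mapsTo_empty _ _)
  exact ⟨_, hg PUnit.unit⟩

/-- A retract of an absolute extensor is an absolute extensor. -/
lemma of_retract {F : Type u} [TopologicalSpace F] {t : Set F} (hs : IsAbsoluteExtensor s)
    {i : F → E} {r : E → F} (hi : Continuous i) (hr : Continuous r) (hi' : Set.MapsTo i t s)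
    (hr' : Set.MapsTo r s t) (h : ∀ x ∈ t, r (i x) = x) : IsAbsoluteExtensor t := by
  intro Z _ C f hC hf hft
  obtain ⟨g, hg, hgs, hgf⟩ := hs Z C (i ∘ f) hC (hi.comp_continuousOn hf) (hi'.comp hft)
  exact ⟨r ∘ g, hr.comp hg, fun z => hr' (hgs z), fun z hz => by
    simp [hgf hz, h _ (hft hz)]⟩

lemma prod {F : Type u} [TopologicalSpace F] {t : Set F} (hs : IsAbsoluteExtensor s)
    (ht : IsAbsoluteExtensor t) : IsAbsoluteExtensor (s ×ˢ t) := by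
  intro Z _ C f hC hf hfst
  obtain ⟨g, hg, hgs, hgf⟩ := hs Z C (fun z => (f z).1) hC (continuous_fst.comp_continuousOn hf)
    fun z hz => (hfst hz).1
  obtain ⟨g', hg', hgs', hgf'⟩ := ht Z C (fun z => (f z).2) hC
    (continuous_snd.comp_continuousOn hf) fun z hz => (hfst hz).2
  exact ⟨fun z => (g z, g' z), hg.prodMk hg', fun z => ⟨hgs z, hgs' z⟩,
    fun z hz => Prod.ext (hgf hz) (hgf' hz)⟩

/-- Tietze's extension theorem. -/
lemma Icc {a b : ℝ≥0} (hab : a ≤ b) : IsAbsoluteExtensor (Set.Icc a b) := by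
  intro Z _ C f hC hf hfab
  obtain ⟨g, hg⟩ := ContinuousMap.exists_restrict_eq hC ⟨C.domRestrict f, hf.domRestrict⟩
  refine ⟨fun z => max a (min b (g z)), by fun_prop, fun z => ⟨le_max_left _ _,
    max_le hab (min_le_left _ _)⟩, fun z hz => ?_⟩
  have : g z = f z := congrArg (fun k => k ⟨z, hz⟩) hg
  simp [this, (hfab hz).1, (hfab hz).2]

/-- The union of two closed absolute extensors whose intersection is an absolute extensor is an
absolute extensor. -/
lemma union (hA : IsAbsoluteExtensor A) (hB : IsAbsoluteExtensor B)
    (hAB : IsAbsoluteExtensor (A ∩ B)) (hA' : IsClosed A) (hB' : IsClosed B) :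
    IsAbsoluteExtensor (A ∪ B) := by
  intro Z _ C f hC hf hfs
  have hCA := hf.preimage_isClosed_of_isClosed hC hA'
  have hCB := hf.preimage_isClosed_of_isClosed hC hB'
  have hCAB {z} (hz : z ∈ C) : z ∈ C ∩ f ⁻¹' A ∨ z ∈ C ∩ f ⁻¹' B :=
    (hfs hz).imp (⟨hz, ·⟩) (⟨hz, ·⟩)
  set CA := C ∩ f ⁻¹' A with hCA_def
  set CB := C ∩ f ⁻¹' B with hCB_def
  obtain hA0 | hA0 := CA.eq_empty_or_nonempty
  · obtain ⟨g, hg, hgs, hgf⟩ := hB Z C f hC hf fun z hz => by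
      obtain h | h := hCAB hz
      · simp [hA0] at h
      · exact h.2
    exact ⟨g, hg, fun z => .inr (hgs z), hgf⟩
  obtain hB0 | hB0 := CB.eq_empty_or_nonempty
  · obtain ⟨g, hg, hgs, hgf⟩ := hA Z C f hC hf fun z hz => by
      obtain h | h := hCAB hz
      · exact h.2
      · simp [hB0] at h
    exact ⟨g, hg, fun z => .inl (hgs z), hgf⟩
  -- The points equidistant from `CA` and `CB` separate the points sent to `A` from those
  -- sent to `B`; extend to this wall first, and then to each side.
  set W : Set Z := {z | Metric.infDist z CA = Metric.infDist z CB} with hW_def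
  have hcA : Continuous fun z => Metric.infDist z CA := Metric.continuous_infDist_pt _
  have hcB : Continuous fun z => Metric.infDist z CB := Metric.continuous_infDist_pt _
  have hW : IsClosed W := isClosed_eq hcA hcB
  have memA {z} (h : Metric.infDist z CA = 0) : z ∈ CA :=
    (hCA.mem_iff_infDist_zero hA0).mpr h
  have memB {z} (h : Metric.infDist z CB = 0) : z ∈ CB :=
    (hCB.mem_iff_infDist_zero hB0).mpr h
  have zeroA {z} (h : z ∈ CA) : Metric.infDist z CA = 0 := Metric.infDist_zero_of_mem h
  have zeroB {z} (h : z ∈ CB) : Metric.infDist z CB = 0 := Metric.infDist_zero_of_mem h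
  have hWC : Set.MapsTo f (C ∩ W) (A ∩ B) := by
    rintro z ⟨hz, hzW⟩
    obtain h | h := hCAB hz
    · exact ⟨h.2, (memB (hzW.symm.trans (zeroA h))).2⟩
    · exact ⟨(memA (hzW.trans (zeroB h))).2, h.2⟩
  obtain ⟨g₀, hg₀, hg₀s, hg₀f⟩ := hAB Z (C ∩ W) f (hC.inter hW) (hf.mono Set.inter_subset_left) hWC
  classical
  have key {D : Set E} (hD : IsAbsoluteExtensor D) (hDs : A ∩ B ⊆ D) {CD : Set Z}
      (hCD : IsClosed CD) (hCDC : CD ⊆ C) (hCDD : Set.MapsTo f CD D) :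
      ∃ g : Z → E, Continuous g ∧ (∀ z, g z ∈ D) ∧ Set.EqOn g g₀ W ∧ Set.EqOn g f CD := by
    have h₁ : Set.EqOn (W.piecewise g₀ f) g₀ W := Set.piecewise_eqOn _ _ _
    have h₂ : Set.EqOn (W.piecewise g₀ f) f CD := fun z hz => by
      by_cases hzW : z ∈ W
      · rw [Set.piecewise_eq_of_mem _ _ _ hzW, hg₀f ⟨hCDC hz, hzW⟩]
      · rw [Set.piecewise_eq_of_notMem _ _ _ hzW]
    obtain ⟨g, hg, hgs, hgf⟩ := hD Z (W ∪ CD) (W.piecewise g₀ f) (hW.union hCD)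
      ((hg₀.continuousOn.congr h₁).union_of_isClosed ((hf.mono hCDC).congr h₂) hW hCD) (by
        rintro z (hz | hz)
        · rw [h₁ hz]
          exact hDs (hg₀s z)
        · rw [h₂ hz]
          exact hCDD hz)
    exact ⟨g, hg, hgs, fun z hz => (hgf (.inl hz)).trans (h₁ hz),
      fun z hz => (hgf (.inr hz)).trans (h₂ hz)⟩
  obtain ⟨gA, hgA, hgAs, hgAW, hgAf⟩ := key hA Set.inter_subset_left hCA Set.inter_subset_left
    fun z hz => hz.2
  obtain ⟨gB, hgB, hgBs, hgBW, hgBf⟩ := key hB Set.inter_subset_right hCB Set.inter_subset_left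
    fun z hz => hz.2
  refine ⟨fun z => if Metric.infDist z CA ≤ Metric.infDist z CB then gA z else gB z,
    hgA.if_le hgB hcA hcB fun z hz => (hgAW hz).trans (hgBW hz).symm, fun z => ?_, fun z hz => ?_⟩
  · beta_reduce
    split_ifs
    exacts [.inl (hgAs z), .inr (hgBs z)]
  · beta_reduce
    split_ifs with h
    · refine hgAf ((hCAB hz).elim id fun h' => memA (le_antisymm ?_ Metric.infDist_nonneg))
      exact h.trans (zeroB h').le
    · refine hgBf ((hCAB hz).elim (fun h' => absurd ?_ h) id)
      exact (zeroA h').le.trans Metric.infDist_nonneg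

lemma contractibleSpace {E : Type u} [MetricSpace E] [Nonempty E] {s : Set E}
    (hs : IsAbsoluteExtensor s) : ContractibleSpace s := by
  obtain ⟨x₀, hx₀⟩ := hs.nonempty
  -- Extend the map which is the identity on `s × {0}` and constant on `s × {1}`.
  obtain ⟨g, hg, hgs, hgf⟩ := hs (s × unitInterval)
    (Prod.snd ⁻¹' {0} ∪ Prod.snd ⁻¹' {1})
    (fun z => if (z.2 : ℝ) ≤ 1 / 2 then z.1 else x₀)
    ((isClosed_singleton.preimage continuous_snd).union
      (isClosed_singleton.preimage continuous_snd)) (by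
      refine ContinuousOn.union_of_isClosed (s := Prod.snd ⁻¹' {0})
        (t := Prod.snd ⁻¹' {1}) ?_ ?_
        (isClosed_singleton.preimage continuous_snd) (isClosed_singleton.preimage continuous_snd)
      · refine (continuous_subtype_val.comp continuous_fst).continuousOn.congr fun z hz => ?_
        rw [Set.mem_preimage, Set.mem_singleton_iff] at hz
        simp [hz]
      · refine (continuous_const (y := x₀)).continuousOn.congr fun z hz => ?_
        rw [Set.mem_preimage, Set.mem_singleton_iff] at hz
        norm_num [hz])
    (by
      intro z _
      beta_reduce
      split_ifs
      exacts [z.1.2, hx₀])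
  refine (contractible_iff_id_nullhomotopic s).mpr ⟨⟨x₀, hx₀⟩, ⟨⟨⟨fun z => ⟨g (z.2, z.1), hgs _⟩,
    by fun_prop⟩, fun x => ?_, fun x => ?_⟩⟩⟩
  · apply Subtype.ext
    have := hgf (x := (x, 0)) (.inl rfl)
    simpa using this
  · apply Subtype.ext
    have := hgf (x := (x, 1)) (.inr rfl)
    norm_num at this
    simpa using this

end IsAbsoluteExtensor

/-! ### Chain matrices -/

section rowBounds

variable {α β : Type*}

/-- The matrices `f` whose row maxima lie between `l` and `u`. In a row on which `l` vanishes there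
is no lower bound, also if there are no columns. -/
def rowBounds (l u : α → ℝ≥0) : Set (α × β → ℝ≥0) :=
  {f | (∀ a b, f (a, b) ≤ u a) ∧ ∀ a, l a ≠ 0 → ∃ b, l a ≤ f (a, b)}

lemma isClosed_rowBounds [Finite β] (l u : α → ℝ≥0) :
    IsClosed (rowBounds l u : Set (α × β → ℝ≥0)) := by
  simp only [rowBounds, Set.ofPred_and, Set.ofPred_forall, Set.ofPred_exists]
  refine (isClosed_iInter fun a => isClosed_iInter fun b => ?_).inter
    (isClosed_iInter fun a => isClosed_iInter fun _ => isClosed_iUnion_of_finite fun b => ?_)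
  · exact isClosed_le (continuous_apply _) continuous_const
  · exact isClosed_le continuous_const (continuous_apply _)

lemma rowBounds_mono {l u L U : α → ℝ≥0} (hl : L ≤ l) (hu : u ≤ U) :
    (rowBounds l u : Set (α × β → ℝ≥0)) ⊆ rowBounds L U := by
  intro f hf
  refine ⟨fun a b => (hf.1 a b).trans (hu a), fun a ha => ?_⟩
  obtain ⟨b, hb⟩ := hf.2 a fun h => ha (le_antisymm ((hl a).trans h.le) zero_le)
  exact ⟨b, (hl a).trans hb⟩

variable [DecidableEq α] [DecidableEq β] {l u L U : α → ℝ≥0} {f : α × β → ℝ≥0} {r : α} {s : β}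

lemma update_mem_rowBounds (hf : f ∈ rowBounds L U) (hU : ∀ a, a ≠ r → U a ≤ u a)
    (hL : ∀ a, a ≠ r → l a ≤ L a) (hu : ∀ b, b ≠ s → f (r, b) ≤ u r)
    (hl : l r = 0 ∨ ∃ b, b ≠ s ∧ l r ≤ f (r, b)) :
    Function.update f (r, s) 0 ∈ rowBounds l u := by
  refine ⟨fun a b => ?_, fun a ha => ?_⟩
  · by_cases h : (a, b) = (r, s)
    · simp [h]
    · rw [Function.update_of_ne h]
      by_cases har : a = r
      · subst har
        exact hu b fun hb => h (by rw [hb])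
      · exact (hf.1 a b).trans (hU a har)
  · by_cases har : a = r
    · subst har
      obtain ⟨b, hb, h⟩ := hl.resolve_left ha
      exact ⟨b, by rwa [Function.update_of_ne (by simpa using hb)]⟩
    · obtain ⟨b, hb⟩ := hf.2 a fun h => ha (le_antisymm ((hL a har).trans h.le) zero_le)
      exact ⟨b, by rw [Function.update_of_ne (by simp [har])]; exact (hL a har).trans hb⟩

lemma mem_rowBounds_of_update (hf : Function.update f (r, s) 0 ∈ rowBounds l u)
    (hu : ∀ a, u a ≤ U a) (hU : f (r, s) ≤ U r) (hl : ∀ a, a ≠ r → L a ≤ l a)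
    (hL : L r ≤ l r ∨ L r ≤ f (r, s)) : f ∈ rowBounds L U := by
  have key {a : α} (ha : L a ≠ 0) (h : L a ≤ l a) : ∃ b, L a ≤ f (a, b) := by
    have hla : l a ≠ 0 := fun h' => ha (le_antisymm (h.trans h'.le) zero_le)
    obtain ⟨b, hb⟩ := hf.2 a hla
    have hne : (a, b) ≠ (r, s) := fun h' => by
      rw [h', Function.update_self] at hb
      exact hla (le_antisymm hb zero_le)
    rw [Function.update_of_ne hne] at hb
    exact ⟨b, h.trans hb⟩
  refine ⟨fun a b => ?_, fun a ha => ?_⟩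
  · by_cases h : (a, b) = (r, s)
    · obtain ⟨rfl, rfl⟩ := Prod.mk.inj h
      exact hU
    · have := hf.1 a b
      rw [Function.update_of_ne h] at this
      exact this.trans (hu a)
  · by_cases har : a = r
    · subst har
      exact hL.elim (key ha) fun h => ⟨s, h⟩
    · exact key ha (hl a har)

lemma update_comp_swap (f : α × β → ℝ≥0) (r : α) (s : β) (e : ℝ≥0) :
    Function.update f (r, s) e ∘ Prod.swap = Function.update (f ∘ Prod.swap) (s, r) e :=
  Function.update_comp_equiv f (Equiv.prodComm β α) (r, s) e

end rowBounds

section boundedChainMatrices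

variable {α β : Type*} [LinearOrder α] [LinearOrder β]

/-- The space of matrices whose nonzero entries form a chain, with lower and upper bounds for the
row maxima and the column maxima. -/
def boundedChainMatrices (l₁ u₁ : α → ℝ≥0) (l₂ u₂ : β → ℝ≥0) : Set (α × β → ℝ≥0) :=
  {f | (∀ p q, f p ≠ 0 → f q ≠ 0 → p ≤ q ∨ q ≤ p) ∧ f ∈ rowBounds l₁ u₁ ∧
    f ∘ Prod.swap ∈ rowBounds l₂ u₂}

variable {l₁ u₁ L₁ U₁ h₁ : α → ℝ≥0} {l₂ u₂ L₂ U₂ h₂ : β → ℝ≥0} {f : α × β → ℝ≥0} {r : α} {s : β}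

lemma isClosed_boundedChainMatrices [Finite α] [Finite β] (l₁ u₁ : α → ℝ≥0) (l₂ u₂ : β → ℝ≥0) :
    IsClosed (boundedChainMatrices l₁ u₁ l₂ u₂) := by
  refine IsClosed.inter ?_ ((isClosed_rowBounds _ _).inter
    ((isClosed_rowBounds _ _).preimage (Pi.continuous_precomp _)))
  have (p q : α × β) (f : α × β → ℝ≥0) : (f p ≠ 0 → f q ≠ 0 → p ≤ q ∨ q ≤ p) ↔
      (¬ (p ≤ q ∨ q ≤ p) → f p = 0 ∨ f q = 0) := by tauto
  change IsClosed ({f | ∀ p q, f p ≠ 0 → f q ≠ 0 → p ≤ q ∨ q ≤ p} : Set (α × β → ℝ≥0))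
  simp only [this, Set.ofPred_forall]
  refine isClosed_iInter fun p => isClosed_iInter fun q => isClosed_iInter fun _ => ?_
  exact (isClosed_eq (continuous_apply p) continuous_const).union
    (isClosed_eq (continuous_apply q) continuous_const)

lemma comp_swap_mem_boundedChainMatrices (hf : f ∈ boundedChainMatrices l₁ u₁ l₂ u₂) :
    f ∘ Prod.swap ∈ boundedChainMatrices l₂ u₂ l₁ u₁ :=
  ⟨fun p q hp hq => (hf.1 _ _ hp hq).imp Prod.swap_le_swap.mp Prod.swap_le_swap.mp, hf.2.2,
    by simpa [Function.comp_assoc] using hf.2.1⟩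

lemma boundedChainMatrices_mono (hl₁ : L₁ ≤ l₁) (hu₁ : u₁ ≤ U₁) (hl₂ : L₂ ≤ l₂)
    (hu₂ : u₂ ≤ U₂) : boundedChainMatrices l₁ u₁ l₂ u₂ ⊆ boundedChainMatrices L₁ U₁ L₂ U₂ :=
  fun _ hf => ⟨hf.1, rowBounds_mono hl₁ hu₁ hf.2.1, rowBounds_mono hl₂ hu₂ hf.2.2⟩

lemma boundedChainMatrices_inter (hu₁ : u₁ ≤ U₁) (hu₂ : U₂ ≤ u₂) :
    boundedChainMatrices l₁ u₁ l₂ u₂ ∩ boundedChainMatrices l₁ U₁ l₂ U₂ =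
      boundedChainMatrices l₁ u₁ l₂ U₂ :=
  subset_antisymm (fun _ hf => ⟨hf.1.1, hf.1.2.1, hf.2.2.2⟩) (Set.subset_inter
    (boundedChainMatrices_mono le_rfl le_rfl le_rfl hu₂)
    (boundedChainMatrices_mono le_rfl hu₁ le_rfl le_rfl))

lemma le_of_mem_boundedChainMatrices (hf : f ∈ boundedChainMatrices l₁ u₁ l₂ u₂) (a : α) (b : β) :
    f (a, b) ≤ u₁ a ∧ f (a, b) ≤ u₂ b :=
  ⟨hf.2.1.1 a b, hf.2.2.1 b a⟩

lemma sup_le_sup_of_mem [Fintype α] [Fintype β] (hf : f ∈ boundedChainMatrices l₁ u₁ l₂ u₂) :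
    Finset.univ.sup l₁ ≤ Finset.univ.sup u₂ ∧ Finset.univ.sup l₂ ≤ Finset.univ.sup u₁ := by
  constructor <;> refine Finset.sup_le fun a _ => ?_
  · obtain ha | ha := eq_or_ne (l₁ a) 0
    · simp [ha]
    · obtain ⟨b, hb⟩ := hf.2.1.2 a ha
      exact (hb.trans (hf.2.2.1 b a)).trans (Finset.le_sup (Finset.mem_univ b))
  · obtain ha | ha := eq_or_ne (l₂ a) 0
    · simp [ha]
    · obtain ⟨b, hb⟩ := hf.2.2.2 a ha
      exact (hb.trans (hf.2.1.1 b a)).trans (Finset.le_sup (Finset.mem_univ b))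

lemma boundedChainMatrices_eq_zero (hl₁ : ∀ a, l₁ a = 0) (hl₂ : ∀ b, l₂ b = 0)
    (hu₂ : ∀ b, u₂ b = 0) : boundedChainMatrices l₁ u₁ l₂ u₂ = {0} := by
  ext f
  refine ⟨fun hf => ?_, ?_⟩
  · funext p
    exact le_antisymm ((hf.2.2.1 p.2 p.1).trans (hu₂ _).le) zero_le
  · rintro rfl
    exact ⟨fun p q h => absurd rfl h, ⟨fun _ _ => zero_le, fun a h => absurd (hl₁ a) h⟩,
      ⟨fun _ _ => zero_le, fun a h => absurd (hl₂ a) h⟩⟩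

/-- A chain which is contained in the rows up to `r` and the columns up to `s` meets the row `r`
or the column `s` at most in the corner. -/
lemma row_or_col_eq_zero (hf : f ∈ boundedChainMatrices l₁ u₁ l₂ u₂)
    (hr : ∀ a, u₁ a ≠ 0 → a ≤ r) (hs : ∀ b, u₂ b ≠ 0 → b ≤ s) :
    (∀ b, b ≠ s → f (r, b) = 0) ∨ (∀ a, a ≠ r → f (a, s) = 0) := by
  by_contra! ⟨⟨b, hb, hfb⟩, ⟨a, ha, hfa⟩⟩
  have hb' : b < s := lt_of_le_of_ne (hs b fun h => hfb
    (le_antisymm ((hf.2.2.1 b r).trans h.le) zero_le)) hb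
  have ha' : a < r := lt_of_le_of_ne (hr a fun h => hfa
    (le_antisymm ((hf.2.1.1 a s).trans h.le) zero_le)) ha
  obtain h | h := hf.1 _ _ hfb hfa
  · exact absurd h.1 ha'.not_ge
  · exact absurd h.2 hb'.not_ge

lemma isChain_update_zero (hf : ∀ p q, f p ≠ 0 → f q ≠ 0 → p ≤ q ∨ q ≤ p) (p₀ : α × β) :
    ∀ p q, Function.update f p₀ 0 p ≠ 0 → Function.update f p₀ 0 q ≠ 0 → p ≤ q ∨ q ≤ p := by
  intro p q hp hq
  refine hf p q (fun h => hp ?_) fun h => hq ?_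
  · rw [Function.update_apply, h, ite_self]
  · rw [Function.update_apply, h, ite_self]

/-- Putting an entry into the last corner `(r, s)` of a matrix in a space of chain matrices, with
the effect on the bounds. -/
lemma mem_of_update_zero_mem
    (hf : Function.update f (r, s) 0 ∈ boundedChainMatrices l₁ u₁ l₂ u₂)
    (hr : ∀ a, U₁ a ≠ 0 → a ≤ r) (hs : ∀ b, U₂ b ≠ 0 → b ≤ s)
    (hu₁ : ∀ a, u₁ a ≤ U₁ a) (hu₂ : ∀ b, u₂ b ≤ U₂ b) (hU₁ : f (r, s) ≤ U₁ r)
    (hU₂ : f (r, s) ≤ U₂ s) (hl₁ : ∀ a, a ≠ r → L₁ a ≤ l₁ a) (hl₂ : ∀ b, b ≠ s → L₂ b ≤ l₂ b)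
    (hL₁ : L₁ r ≤ l₁ r ∨ L₁ r ≤ f (r, s)) (hL₂ : L₂ s ≤ l₂ s ∨ L₂ s ≤ f (r, s)) :
    f ∈ boundedChainMatrices L₁ U₁ L₂ U₂ := by
  have h₁ := mem_rowBounds_of_update hf.2.1 hu₁ hU₁ hl₁ hL₁
  have h₂ : f ∘ Prod.swap ∈ rowBounds L₂ U₂ :=
    mem_rowBounds_of_update (update_comp_swap f r s 0 ▸ hf.2.2) hu₂ hU₂ hl₂ hL₂
  have hle (p : α × β) (hp : f p ≠ 0) : p ≤ (r, s) :=
    ⟨hr _ fun h => hp (le_antisymm ((h₁.1 _ _).trans h.le) zero_le),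
      hs _ fun h => hp (le_antisymm ((h₂.1 p.2 p.1).trans h.le) zero_le)⟩
  refine ⟨fun p q hp hq => ?_, h₁, h₂⟩
  by_cases hp' : p = (r, s)
  · exact .inr (hp' ▸ hle q hq)
  by_cases hq' : q = (r, s)
  · exact .inl (hq' ▸ hle p hp)
  · exact hf.1 p q (by rwa [Function.update_of_ne hp']) (by rwa [Function.update_of_ne hq'])

/-- Erasing the corner entry `(r, s)` of a matrix in a space of chain matrices, with the effect on
the bounds. -/
lemma update_zero_mem (hf : f ∈ boundedChainMatrices L₁ U₁ L₂ U₂)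
    (hU₁ : ∀ a, a ≠ r → U₁ a ≤ u₁ a) (hL₁ : ∀ a, a ≠ r → l₁ a ≤ L₁ a)
    (hu₁ : ∀ b, b ≠ s → f (r, b) ≤ u₁ r) (hl₁ : l₁ r = 0 ∨ ∃ b, b ≠ s ∧ l₁ r ≤ f (r, b))
    (hU₂ : ∀ b, b ≠ s → U₂ b ≤ u₂ b) (hL₂ : ∀ b, b ≠ s → l₂ b ≤ L₂ b)
    (hu₂ : ∀ a, a ≠ r → f (a, s) ≤ u₂ s) (hl₂ : l₂ s = 0 ∨ ∃ a, a ≠ r ∧ l₂ s ≤ f (a, s)) :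
    Function.update f (r, s) 0 ∈ boundedChainMatrices l₁ u₁ l₂ u₂ := by
  refine ⟨isChain_update_zero hf.1 _, update_mem_rowBounds hf.2.1 hU₁ hL₁ hu₁ hl₁, ?_⟩
  rw [update_comp_swap]
  exact update_mem_rowBounds hf.2.2 hU₂ hL₂ hu₂ hl₂

/-- The functions which arise from those in `S` by putting a number from the interval `[x, y]` at
the place `p`. This presumes that the functions in `S` vanish at `p`. -/
def insertEntry {γ : Type*} [DecidableEq γ] (S : Set (γ → ℝ≥0)) (p : γ) (x y : ℝ≥0) :
    Set (γ → ℝ≥0) :=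
  {f | Function.update f p 0 ∈ S ∧ f p ∈ Set.Icc x y}

lemma isClosed_insertEntry {γ : Type*} [DecidableEq γ] {S : Set (γ → ℝ≥0)} (hS : IsClosed S)
    (p : γ) (x y : ℝ≥0) : IsClosed (insertEntry S p x y) :=
  (hS.preimage (by fun_prop)).inter (isClosed_Icc.preimage (continuous_apply p))

lemma IsAbsoluteExtensor.insertEntry {γ : Type} [DecidableEq γ] {S : Set (γ → ℝ≥0)}
    (hS : IsAbsoluteExtensor S) {p : γ} (hp : ∀ g ∈ S, g p = 0) {x y : ℝ≥0} (hxy : x ≤ y) :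
    IsAbsoluteExtensor (insertEntry S p x y) := by
  refine (hS.prod (.Icc hxy)).of_retract (i := fun f => (Function.update f p 0, f p))
    (r := fun z => Function.update z.1 p z.2) (by fun_prop) (by fun_prop) (fun f hf => hf)
    (fun z hz => ⟨?_, ?_⟩) fun f _ => by simp
  · have : Function.update (Function.update z.1 p z.2) p 0 = z.1 := by
      rw [Function.update_idem, ← hp _ hz.1, Function.update_eq_self]
    rw [this]
    exact hz.1
  · simpa using hz.2

lemma update_zero_le {γ : Type*} [DecidableEq γ] (h : γ → ℝ≥0) (r : γ) :
    Function.update h r 0 ≤ h :=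
  update_le_iff.mpr ⟨zero_le, fun _ _ => le_rfl⟩

/-- If the bound for the last row, which is only an upper one, is smaller than the maximum of the
last column, then this maximum is not attained in the corner, so that the rest of the last row
vanishes while the corner entry is arbitrary below the bound. -/
lemma relaxed_eq_insertEntry_of_lt (hr : ∀ a, h₁ a ≠ 0 → a ≤ r) (hs : ∀ b, h₂ b ≠ 0 → b ≤ s)
    (h : h₁ r < h₂ s) :
    boundedChainMatrices (Function.update h₁ r 0) h₁ h₂ h₂ =
      insertEntry (boundedChainMatrices (Function.update h₁ r 0) (Function.update h₁ r 0) h₂ h₂)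
        (r, s) 0 (h₁ r) := by
  ext f
  constructor
  · intro hf
    obtain ⟨a, ha⟩ := hf.2.2.2 s (ne_zero_of_lt h)
    have har : a ≠ r := by
      rintro rfl
      exact absurd (ha.trans (hf.2.1.1 _ _)) h.not_ge
    have hrow : ∀ b, b ≠ s → f (r, b) = 0 := (row_or_col_eq_zero hf hr hs).resolve_right fun h' =>
      ne_zero_of_lt h (le_antisymm (ha.trans (h' a har).le) zero_le)
    refine ⟨update_zero_mem hf ?_ ?_ ?_ ?_ ?_ ?_ ?_ ?_, zero_le, hf.2.1.1 _ _⟩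
    · intro a ha; simp [ha]
    · intro a ha; simp
    · intro b hb; simp [hrow b hb]
    · simp
    · simp
    · simp
    · exact fun a _ => hf.2.2.1 s a
    · exact .inr ⟨a, har, ha⟩
  · rintro ⟨hf, -, hf'⟩
    exact mem_of_update_zero_mem hf hr hs (update_zero_le _ _) (fun _ => le_rfl) hf'
      (hf'.trans h.le) (by simp) (by simp) (by simp) (by simp)

/-- If the last row has a larger maximum than the last column, then the row does not attain its
maximum in the corner, so that the rest of the column vanishes. -/
lemma exact_eq_insertEntry_of_lt (hr : ∀ a, h₁ a ≠ 0 → a ≤ r) (hs : ∀ b, h₂ b ≠ 0 → b ≤ s)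
    (hd : h₂ s ≠ 0) (h : h₂ s < h₁ r) :
    boundedChainMatrices h₁ h₁ h₂ h₂ =
      insertEntry (boundedChainMatrices h₁ h₁ (Function.update h₂ s 0) (Function.update h₂ s 0))
        (r, s) (h₂ s) (h₂ s) := by
  ext f
  constructor
  · intro hf
    obtain ⟨b, hb⟩ := hf.2.1.2 r (ne_zero_of_lt h)
    have hbs : b ≠ s := by
      rintro rfl
      exact absurd (hb.trans (hf.2.2.1 _ _)) h.not_ge
    have hcol : ∀ a, a ≠ r → f (a, s) = 0 := (row_or_col_eq_zero hf hr hs).resolve_left fun h' =>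
      ne_zero_of_lt h (le_antisymm (hb.trans (h' b hbs).le) zero_le)
    obtain ⟨a, ha⟩ := hf.2.2.2 s hd
    obtain rfl : a = r := by
      by_contra h'
      exact hd (le_antisymm (ha.trans (hcol a h').le) zero_le)
    refine ⟨update_zero_mem hf ?_ ?_ ?_ ?_ ?_ ?_ ?_ ?_, ha, hf.2.2.1 _ _⟩
    · simp
    · simp
    · exact fun b _ => hf.2.1.1 a b
    · exact .inr ⟨b, hbs, hb⟩
    · intro b hb; simp [hb]
    · intro b hb; simp [hb]
    · intro a ha; simp [hcol a ha]
    · simp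
  · rintro ⟨hf, hf₁, hf₂⟩
    exact mem_of_update_zero_mem hf hr hs (fun _ => le_rfl) (update_zero_le _ _)
      (hf₂.trans h.le) hf₂ (by simp) (fun b hb => by simp [hb]) (by simp) (.inr hf₁)

/-- The matrices whose corner entry at `(r, s)` is `h₂ s` and in which either the rest of the row
`r` or the rest of the column `s` vanishes, while the other one of these is only bounded above. -/
def cornerUnion (h₁ : α → ℝ≥0) (h₂ : β → ℝ≥0) (r : α) (s : β) : Set (α × β → ℝ≥0) :=
  insertEntry (boundedChainMatrices (Function.update h₁ r 0) (Function.update h₁ r 0)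
      (Function.update h₂ s 0) h₂) (r, s) (h₂ s) (h₂ s) ∪
    insertEntry (boundedChainMatrices (Function.update h₁ r 0) h₁
      (Function.update h₂ s 0) (Function.update h₂ s 0)) (r, s) (h₂ s) (h₂ s)

lemma mem_cornerUnion (hr : ∀ a, h₁ a ≠ 0 → a ≤ r) (hs : ∀ b, h₂ b ≠ 0 → b ≤ s)
    (hf : f ∈ boundedChainMatrices (Function.update h₁ r 0) h₁ h₂ h₂) (h : f (r, s) = h₂ s) :
    f ∈ cornerUnion h₁ h₂ r s := by
  have h' : f (r, s) ∈ Set.Icc (h₂ s) (h₂ s) := by simp [h]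
  obtain hrow | hcol := row_or_col_eq_zero hf hr hs
  · refine .inl ⟨update_zero_mem hf ?_ ?_ ?_ ?_ ?_ ?_ ?_ ?_, h'⟩
    · intro a ha; simp [ha]
    · simp
    · intro b hb; simp [hrow b hb]
    · simp
    · simp
    · intro b hb; simp [hb]
    · exact fun a _ => hf.2.2.1 s a
    · simp
  · refine .inr ⟨update_zero_mem hf ?_ ?_ ?_ ?_ ?_ ?_ ?_ ?_, h'⟩
    · simp
    · simp
    · exact fun b _ => hf.2.1.1 r b
    · simp
    · intro b hb; simp [hb]
    · intro b hb; simp [hb]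
    · intro a ha; simp [hcol a ha]
    · simp

lemma cornerUnion_subset (hr : ∀ a, h₁ a ≠ 0 → a ≤ r) (hs : ∀ b, h₂ b ≠ 0 → b ≤ s)
    (h : h₂ s ≤ h₁ r) :
    cornerUnion h₁ h₂ r s ⊆ boundedChainMatrices (Function.update h₁ r 0) h₁ h₂ h₂ := by
  rintro f (⟨hf, hf₁, hf₂⟩ | ⟨hf, hf₁, hf₂⟩)
  · exact mem_of_update_zero_mem hf hr hs (update_zero_le _ _) (fun _ => le_rfl) (hf₂.trans h) hf₂
      (by simp) (fun b hb => by simp [hb]) (by simp) (.inr hf₁)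
  · exact mem_of_update_zero_mem hf hr hs (fun _ => le_rfl) (update_zero_le _ _) (hf₂.trans h) hf₂
      (by simp) (fun b hb => by simp [hb]) (by simp) (.inr hf₁)

/-- If the bound for the last row, which is only an upper one, is at least the maximum of the last
column, then either this maximum is attained in the corner, or it is attained elsewhere in the
column and the rest of the row vanishes. -/
lemma relaxed_eq_union_of_le (hr : ∀ a, h₁ a ≠ 0 → a ≤ r) (hs : ∀ b, h₂ b ≠ 0 → b ≤ s)
    (hd : h₂ s ≠ 0) (h : h₂ s ≤ h₁ r) :
    boundedChainMatrices (Function.update h₁ r 0) h₁ h₂ h₂ =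
      insertEntry (boundedChainMatrices (Function.update h₁ r 0) (Function.update h₁ r 0) h₂ h₂)
        (r, s) 0 (h₂ s) ∪ cornerUnion h₁ h₂ r s := by
  refine subset_antisymm (fun f hf => ?_) (Set.union_subset ?_ (cornerUnion_subset hr hs h))
  · obtain h' | h' := eq_or_ne (f (r, s)) (h₂ s)
    · exact .inr (mem_cornerUnion hr hs hf h')
    · obtain ⟨a, ha⟩ := hf.2.2.2 s hd
      have har : a ≠ r := by
        rintro rfl
        exact h' (le_antisymm (hf.2.2.1 _ _) ha)
      have hrow : ∀ b, b ≠ s → f (r, b) = 0 :=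
        (row_or_col_eq_zero hf hr hs).resolve_right fun h' =>
          hd (le_antisymm (ha.trans (h' a har).le) zero_le)
      refine .inl ⟨update_zero_mem hf ?_ ?_ ?_ ?_ ?_ ?_ ?_ ?_, zero_le, hf.2.2.1 _ _⟩
      · intro a ha; simp [ha]
      · simp
      · intro b hb; simp [hrow b hb]
      · simp
      · simp
      · simp
      · exact fun a _ => hf.2.2.1 s a
      · exact .inr ⟨a, har, ha⟩
  · rintro f ⟨hf, -, hf'⟩
    exact mem_of_update_zero_mem hf hr hs (update_zero_le _ _) (fun _ => le_rfl) (hf'.trans h) hf'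
      (by simp) (by simp) (by simp) (by simp)

/-- If the last row and the last column have the same maximum, then it is attained in the corner. -/
lemma exact_eq_cornerUnion (hr : ∀ a, h₁ a ≠ 0 → a ≤ r) (hs : ∀ b, h₂ b ≠ 0 → b ≤ s)
    (hd : h₂ s ≠ 0) (h : h₂ s = h₁ r) :
    boundedChainMatrices h₁ h₁ h₂ h₂ = cornerUnion h₁ h₂ r s := by
  refine subset_antisymm (fun f hf => ?_) fun f hf => ?_
  · refine mem_cornerUnion hr hs (boundedChainMatrices_mono (update_zero_le _ _) le_rfl le_rfl
      le_rfl hf) (le_antisymm (hf.2.2.1 _ _) ?_)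
    obtain ⟨a, ha⟩ := hf.2.2.2 s hd
    obtain ⟨b, hb⟩ := hf.2.1.2 r (h ▸ hd)
    by_contra hlt
    obtain h' | h' := row_or_col_eq_zero hf hr hs
    · obtain rfl | hne := eq_or_ne b s
      · exact hlt (h.trans_le hb)
      · exact hd (le_antisymm ((h.trans_le hb).trans (h' b hne).le) zero_le)
    · obtain rfl | hne := eq_or_ne a r
      · exact hlt ha
      · exact hd (le_antisymm (ha.trans (h' a hne).le) zero_le)
  · have hf' := cornerUnion_subset hr hs h.le hf
    refine ⟨hf'.1, ⟨hf'.2.1.1, fun a ha => ?_⟩, hf'.2.2⟩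
    obtain rfl | har := eq_or_ne a r
    · refine ⟨s, h.symm.trans_le ?_⟩
      obtain hf | hf := hf <;> exact hf.2.1
    · have := hf'.2.1.2 a
      rw [Function.update_of_ne har] at this
      exact this ha

lemma insertEntry_inter_cornerUnion :
    insertEntry (boundedChainMatrices (Function.update h₁ r 0) (Function.update h₁ r 0) h₂ h₂)
        (r, s) 0 (h₂ s) ∩ cornerUnion h₁ h₂ r s =
      insertEntry (boundedChainMatrices (Function.update h₁ r 0) (Function.update h₁ r 0) h₂ h₂)
        (r, s) (h₂ s) (h₂ s) := by
  refine subset_antisymm (fun f hf => ⟨hf.1.1, ?_⟩) fun f hf => ⟨⟨hf.1, zero_le, hf.2.2⟩,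
    .inl ⟨boundedChainMatrices_mono le_rfl le_rfl (update_zero_le _ _) le_rfl hf.1, hf.2⟩⟩
  obtain hf | hf := hf.2 <;> exact hf.2

end boundedChainMatrices

/-! ### Spaces of chain matrices are absolute extensors -/

section

variable {γ : Type*} [Fintype γ] [DecidableEq γ]

lemma sup_update_zero_of_lt {h : γ → ℝ≥0} {r : γ} (hr : h r < Finset.univ.sup h) :
    Finset.univ.sup (Function.update h r 0) = Finset.univ.sup h := by
  refine le_antisymm (Finset.sup_mono_fun fun a _ => update_zero_le h r a) ?_
  obtain ⟨a, -, ha⟩ := Finset.exists_mem_eq_sup Finset.univ ⟨r, Finset.mem_univ r⟩ h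
  have har : a ≠ r := by
    rintro rfl
    exact hr.ne ha.symm
  rw [ha, ← Function.update_of_ne (v := 0) har (f := h)]
  exact Finset.le_sup (Finset.mem_univ a)

lemma card_support_update {h : γ → ℝ≥0} {r : γ} (hr : h r ≠ 0) :
    (Finset.univ.filter fun a => Function.update h r 0 a ≠ 0).card + 1 =
      (Finset.univ.filter fun a => h a ≠ 0).card := by
  have : (Finset.univ.filter fun a => Function.update h r 0 a ≠ 0) =
      (Finset.univ.filter fun a => h a ≠ 0).erase r := by
    ext a
    by_cases ha : a = r <;> simp [ha]
  rw [this, Finset.card_erase_add_one (by simpa using hr)]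

lemma exists_last {γ : Type*} [Fintype γ] [LinearOrder γ] {h : γ → ℝ≥0} (hh : ¬ ∀ b, h b = 0) :
    ∃ s, h s ≠ 0 ∧ ∀ b, h b ≠ 0 → b ≤ s := by
  push Not at hh
  obtain ⟨b, hb⟩ := hh
  have hne : (Finset.univ.filter fun a => h a ≠ 0).Nonempty := ⟨b, by simpa using hb⟩
  refine ⟨_, (Finset.mem_filter.mp (Finset.max'_mem _ hne)).2, fun b hb => ?_⟩
  exact Finset.le_max' _ _ (by simpa using hb)

end

section

variable {α β : Type} [LinearOrder α] [LinearOrder β] [Fintype α] [Fintype β]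
  {h₁ : α → ℝ≥0} {h₂ : β → ℝ≥0} {r : α} {s : β}

omit [Fintype α] [Fintype β] in
lemma IsAbsoluteExtensor.boundedChainMatrices_swap {l₁ u₁ : α → ℝ≥0} {l₂ u₂ : β → ℝ≥0}
    (h : IsAbsoluteExtensor (boundedChainMatrices l₁ u₁ l₂ u₂)) :
    IsAbsoluteExtensor (boundedChainMatrices l₂ u₂ l₁ u₁) :=
  h.of_retract (Pi.continuous_precomp Prod.swap) (Pi.continuous_precomp Prod.swap)
    (fun _ hf => comp_swap_mem_boundedChainMatrices hf)
    (fun _ hf => comp_swap_mem_boundedChainMatrices hf)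
    fun f _ => by simp [Function.comp_assoc]

lemma isClosed_cornerUnion : IsClosed (cornerUnion h₁ h₂ r s) :=
  (isClosed_insertEntry (isClosed_boundedChainMatrices _ _ _ _) _ _ _).union
    (isClosed_insertEntry (isClosed_boundedChainMatrices _ _ _ _) _ _ _)

/-- Either one of the two parts of `cornerUnion` is empty, or the maxima of the remaining rows and
columns agree, so that their intersection is a nonempty space of chain matrices. -/
lemma isAbsoluteExtensor_cornerUnion
    (hA : Finset.univ.sup (Function.update h₂ s 0) ≤ Finset.univ.sup (Function.update h₁ r 0) →
      IsAbsoluteExtensor (boundedChainMatrices (Function.update h₁ r 0) (Function.update h₁ r 0)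
        (Function.update h₂ s 0) h₂))
    (hB : Finset.univ.sup (Function.update h₁ r 0) ≤ Finset.univ.sup (Function.update h₂ s 0) →
      IsAbsoluteExtensor (boundedChainMatrices (Function.update h₁ r 0) h₁
        (Function.update h₂ s 0) (Function.update h₂ s 0)))
    (hAB : Finset.univ.sup (Function.update h₁ r 0) = Finset.univ.sup (Function.update h₂ s 0) →
      IsAbsoluteExtensor (boundedChainMatrices (Function.update h₁ r 0) (Function.update h₁ r 0)
        (Function.update h₂ s 0) (Function.update h₂ s 0))) :
    IsAbsoluteExtensor (cornerUnion h₁ h₂ r s) := by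
  have hA' (h) := (hA h).insertEntry (p := (r, s)) (fun g hg => le_antisymm
    ((le_of_mem_boundedChainMatrices hg r s).1.trans (by simp)) zero_le) (le_refl (h₂ s))
  have hB' (h) := (hB h).insertEntry (p := (r, s)) (fun g hg => le_antisymm
    ((le_of_mem_boundedChainMatrices hg r s).2.trans (by simp)) zero_le) (le_refl (h₂ s))
  obtain h | h | h := lt_trichotomy (Finset.univ.sup (Function.update h₁ r 0))
    (Finset.univ.sup (Function.update h₂ s 0))
  · rw [cornerUnion, Set.eq_empty_of_forall_notMem (s := insertEntry _ _ _ _)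
      fun f hf => h.not_ge (sup_le_sup_of_mem hf.1).2, Set.empty_union]
    exact hB' h.le
  · refine (hA' h.ge).union (hB' h.le) ?_
      (isClosed_insertEntry (isClosed_boundedChainMatrices _ _ _ _) _ _ _)
      (isClosed_insertEntry (isClosed_boundedChainMatrices _ _ _ _) _ _ _)
    have := (hAB h).insertEntry (p := (r, s)) (fun g hg => le_antisymm
      ((le_of_mem_boundedChainMatrices hg r s).1.trans (by simp)) zero_le) (le_refl (h₂ s))
    rw [← boundedChainMatrices_inter (update_zero_le _ _) (update_zero_le _ _)] at this
    exact (congrArg IsAbsoluteExtensor (Set.ext fun f => by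
      simp only [insertEntry, Set.mem_inter_iff, Set.mem_ofPred_eq]; tauto)).mp this
  · rw [cornerUnion, Set.eq_empty_of_forall_notMem (s := insertEntry (boundedChainMatrices _ h₁ _ _)
      _ _ _) fun f hf => h.not_ge (sup_le_sup_of_mem hf.1).1, Set.union_empty]
    exact hA' h.le

end

/-- Chain matrices with exact row and column maxima, and those for which the last row has only an
upper bound for its maximum, form absolute extensors, provided that the overall maxima allow such
matrices to exist. The induction runs over the number of rows and columns with nonzero bound, where
the relaxed row counts even if its bound is zero. The statement is over all types so that rows and
columns may be exchanged. -/
lemma isAbsoluteExtensor_exact_and_relaxed (n : ℕ) :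
    ∀ (α β : Type) [LinearOrder α] [LinearOrder β] [Fintype α] [Fintype β]
      (h₁ : α → ℝ≥0) (h₂ : β → ℝ≥0),
    ((Finset.univ.filter fun a => h₁ a ≠ 0).card + (Finset.univ.filter fun b => h₂ b ≠ 0).card < n →
      Finset.univ.sup h₁ = Finset.univ.sup h₂ →
      IsAbsoluteExtensor (boundedChainMatrices h₁ h₁ h₂ h₂)) ∧
    ∀ r, (∀ a, h₁ a ≠ 0 → a ≤ r) →
      (Finset.univ.filter fun a => Function.update h₁ r 0 a ≠ 0).card +
        (Finset.univ.filter fun b => h₂ b ≠ 0).card + 1 < n →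
      Finset.univ.sup (Function.update h₁ r 0) ≤ Finset.univ.sup h₂ →
      Finset.univ.sup h₂ ≤ Finset.univ.sup h₁ →
      IsAbsoluteExtensor (boundedChainMatrices (Function.update h₁ r 0) h₁ h₂ h₂) := by
  induction n with
  | zero => intros; simp
  | succ n ih =>
    intro α β _ _ _ _ h₁ h₂
    have eq_zero {γ : Type} [Fintype γ] {h : γ → ℝ≥0} (hh : Finset.univ.sup h = 0) (c : γ) :
      h c = 0 := le_antisymm ((Finset.le_sup (Finset.mem_univ c)).trans hh.le) zero_le
    have sup_zero {γ : Type} [Fintype γ] {h : γ → ℝ≥0} (hh : ∀ c, h c = 0) :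
      Finset.univ.sup h = 0 := le_antisymm (Finset.sup_le fun c _ => (hh c).le) zero_le
    have sup_mono {γ : Type} [Fintype γ] [DecidableEq γ] (h : γ → ℝ≥0) (c : γ) :
      Finset.univ.sup (Function.update h c 0) ≤ Finset.univ.sup h :=
        Finset.sup_mono_fun fun a _ => update_zero_le h c a
    have hcorner (r : α) (s : β) (hr : ∀ a, h₁ a ≠ 0 → a ≤ r) (hs : ∀ b, h₂ b ≠ 0 → b ≤ s)
        (hd : h₂ s ≠ 0)
        (hn : (Finset.univ.filter fun a => Function.update h₁ r 0 a ≠ 0).card +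
          (Finset.univ.filter fun b => h₂ b ≠ 0).card < n)
        (h₁₂ : Finset.univ.sup (Function.update h₁ r 0) ≤ Finset.univ.sup h₂)
        (h₂₁ : Finset.univ.sup (Function.update h₂ s 0) ≤ Finset.univ.sup h₁) :
        IsAbsoluteExtensor (cornerUnion h₁ h₂ r s) := by
      have hcard := card_support_update hd
      refine isAbsoluteExtensor_cornerUnion (fun h => ?_) (fun h => ?_) (fun h => ?_)
      · exact ((ih β α h₂ (Function.update h₁ r 0)).2 s hs (by omega) h
          h₁₂).boundedChainMatrices_swap
      · exact (ih α β h₁ (Function.update h₂ s 0)).2 r hr (by omega) h h₂₁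
      · exact (ih α β (Function.update h₁ r 0) (Function.update h₂ s 0)).1 (by omega) h
    refine ⟨fun hn h => ?_, fun r hr hn h₁₂ h₂₁ => ?_⟩
    · by_cases h₂0 : ∀ b, h₂ b = 0
      · have h₁0 := eq_zero (h.trans (sup_zero h₂0))
        rw [boundedChainMatrices_eq_zero h₁0 h₂0 h₂0]
        exact .singleton 0
      have h₁0 : ¬ ∀ a, h₁ a = 0 := fun h₁0 => h₂0 (eq_zero (h.symm.trans (sup_zero h₁0)))
      obtain ⟨r, hc, hr⟩ := exists_last h₁0
      obtain ⟨s, hd, hs⟩ := exists_last h₂0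
      have hcard₁ := card_support_update hc
      have hcard₂ := card_support_update hd
      have exact_of_lt {α β : Type} [LinearOrder α] [LinearOrder β] [Fintype α] [Fintype β]
          {h₁ : α → ℝ≥0} {h₂ : β → ℝ≥0} {r : α} {s : β} (hr : ∀ a, h₁ a ≠ 0 → a ≤ r)
          (hs : ∀ b, h₂ b ≠ 0 → b ≤ s) (hd : h₂ s ≠ 0)
          (h : Finset.univ.sup h₁ = Finset.univ.sup h₂)
          (hn : (Finset.univ.filter fun a => h₁ a ≠ 0).card +
            (Finset.univ.filter fun b => h₂ b ≠ 0).card < n + 1) (hlt : h₂ s < h₁ r) :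
          IsAbsoluteExtensor (boundedChainMatrices h₁ h₁ h₂ h₂) := by
        have hcard := card_support_update hd
        rw [exact_eq_insertEntry_of_lt hr hs hd hlt]
        refine ((ih _ _ _ _).1 (by omega) ?_).insertEntry (fun g hg => le_antisymm
          ((le_of_mem_boundedChainMatrices hg r s).2.trans (by simp)) zero_le) le_rfl
        rw [sup_update_zero_of_lt, h]
        exact hlt.trans_le ((Finset.le_sup (Finset.mem_univ r)).trans h.le)
      obtain hlt | heq | hlt := lt_trichotomy (h₂ s) (h₁ r)
      · exact exact_of_lt hr hs hd h hn hlt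
      · rw [exact_eq_cornerUnion hr hs hd heq]
        exact hcorner r s hr hs hd (by omega) ((sup_mono _ _).trans h.le)
          ((sup_mono _ _).trans h.ge)
      · exact (exact_of_lt hs hr hc h.symm (by omega) hlt).boundedChainMatrices_swap
    · by_cases h₂0 : ∀ b, h₂ b = 0
      · rw [boundedChainMatrices_eq_zero
          (eq_zero (le_antisymm (h₁₂.trans (sup_zero h₂0).le) zero_le)) h₂0 h₂0]
        exact .singleton 0
      obtain ⟨s, hd, hs⟩ := exists_last h₂0
      -- The matrices whose row `r` vanishes outside of the corner.
      have hrow (h : Finset.univ.sup (Function.update h₁ r 0) = Finset.univ.sup h₂) (x y : ℝ≥0)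
          (hxy : x ≤ y) : IsAbsoluteExtensor (insertEntry (boundedChainMatrices
            (Function.update h₁ r 0) (Function.update h₁ r 0) h₂ h₂) (r, s) x y) :=
        ((ih _ _ _ _).1 (by omega) h).insertEntry (fun g hg => le_antisymm
          ((le_of_mem_boundedChainMatrices hg r s).1.trans (by simp)) zero_le) hxy
      obtain hlt | hle := lt_or_ge (h₁ r) (h₂ s)
      · rw [relaxed_eq_insertEntry_of_lt hr hs hlt]
        refine hrow (le_antisymm h₁₂ (h₂₁.trans (sup_update_zero_of_lt ?_).ge)) _ _ zero_le
        exact hlt.trans_le ((Finset.le_sup (Finset.mem_univ s)).trans h₂₁)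
      · rw [relaxed_eq_union_of_le hr hs hd hle]
        have hQ := hcorner r s hr hs hd (by omega) h₁₂ ((sup_mono _ _).trans h₂₁)
        by_cases h : Finset.univ.sup (Function.update h₁ r 0) = Finset.univ.sup h₂
        · refine (hrow h _ _ zero_le).union hQ ?_
            (isClosed_insertEntry (isClosed_boundedChainMatrices _ _ _ _) _ _ _)
            isClosed_cornerUnion
          rw [insertEntry_inter_cornerUnion]
          exact hrow h _ _ le_rfl
        · rwa [Set.eq_empty_of_forall_notMem (s := insertEntry _ _ _ _) fun f hf => h
            (le_antisymm (sup_le_sup_of_mem hf.1).1 (sup_le_sup_of_mem hf.1).2), Set.empty_union]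

/-- The space of matrices whose nonzero entries form a chain and which have prescribed row maxima
and column maxima. -/
def chainMatrices {α β : Type*} [Fintype α] [Fintype β] [LinearOrder α] [LinearOrder β]
    (h₁ : α → ℝ≥0) (h₂ : β → ℝ≥0) : Set (α × β → ℝ≥0) :=
  {f | (∀ a b, f a ≠ 0 → f b ≠ 0 → a ≤ b ∨ b ≤ a) ∧
    maxPush Prod.fst f = h₁ ∧ maxPush Prod.snd f = h₂}

lemma chainMatrices_eq_boundedChainMatrices {α β : Type*} [Fintype α] [Fintype β] [LinearOrder α]
    [LinearOrder β] (h₁ : α → ℝ≥0) (h₂ : β → ℝ≥0) :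
    chainMatrices h₁ h₂ = boundedChainMatrices h₁ h₁ h₂ h₂ := by
  ext f
  refine and_congr Iff.rfl (and_congr ?_ ?_) <;> rw [maxPush_eq_iff]
  · simp [rowBounds]
  · simp only [rowBounds, Set.mem_ofPred_eq, Function.comp_apply, Prod.swap_prod_mk, Prod.forall,
      Prod.exists]
    refine and_congr forall_comm (forall₂_congr fun c _ => ?_)
    simp

lemma contractibleSpace_chainMatrices {α β : Type} [Fintype α] [Fintype β] [LinearOrder α]
    [LinearOrder β] {h₁ : α → ℝ≥0} {h₂ : β → ℝ≥0} (h : Finset.univ.sup h₁ = Finset.univ.sup h₂) :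
    ContractibleSpace (chainMatrices h₁ h₂) := by
  rw [chainMatrices_eq_boundedChainMatrices]
  exact ((isAbsoluteExtensor_exact_and_relaxed _ α β h₁ h₂).1 (Nat.lt_succ_self _)
    h).contractibleSpace

/-! ### Finiteness of subdivisions and the fibres of the comparison map -/

namespace SSet

instance finite_sd_obj_simplexCategory (n : SimplexCategory) :
    (SimplexCategory.sd.{u}.obj n).Finite := by
  have : (SimplexCategory.sd.{u}.obj n).HasDimensionLT
      (Fintype.card (Finset (ULift.{u} (Fin (n.len + 1))))) :=
    { degenerate_eq_top := fun k hk => by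
        ext U
        simp only [mem_degenerate_iff_notMem_nonDegenerate, Set.top_eq_univ, Set.mem_univ,
          iff_true]
        intro hU
        have := Fintype.card_le_of_injective _ (flagSet_strictMono hU).injective
        rw [Fintype.card_fin] at this
        lia }
  refine finite_of_hasDimensionLT _ (Fintype.card (Finset (ULift.{u} (Fin (n.len + 1)))))
    fun i _ => ?_
  exact Finite.of_injective (fun U => flagSet (n := n) (k := ⦋i⦌) U.1)
    (flagSet_injective.comp Subtype.val_injective)

instance finite_sd_stdSimplex (n : SimplexCategory) :
    (SSet.sd.{u}.obj (SSet.stdSimplex.obj n)).Finite :=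
  finite_of_iso (stdSimplex.sdIso.{u}.app n).symm

/-- The subdivision of a finite simplicial set is finite. -/
instance finite_sd (X : SSet.{u}) [X.Finite] : (SSet.sd.obj X).Finite := by
  refine finite_of_isColimit (isColimitOfPreserves SSet.sd X.isColimitCoconeN) fun x => ?_
  have h : Epi (SSet.sd.map (Subcomplex.toOfSimplex x.simplex)) := SSet.sd.map_epi _
  exact @finite_of_epi _ _ _ (SSet.sd.map (Subcomplex.toOfSimplex x.simplex)) h

lemma compactSpace_toTop (A : SSet.{u}) [A.Finite] : CompactSpace (SSet.toTop.obj A) := by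
  have h : (⋃ x : A.N, Set.range (cell SSet.toTop x.simplex)) = Set.univ := by
    refine Set.eq_univ_of_forall fun p => ?_
    obtain ⟨n, x, d, hx, -, rfl⟩ := toTopSupportData.exists_normalForm p
    exact Set.mem_iUnion.mpr ⟨N.mk x hx, d, rfl⟩
  rw [← isCompact_univ_iff, ← h]
  refine isCompact_iUnion fun x => ?_
  have : CompactSpace (SSet.toTop.{u}.obj Δ[x.dim]) :=
    (SimplexCategory.toTopHomeo ⦋x.dim⦌).symm.compactSpace
  exact isCompact_range (cell SSet.toTop x.simplex).hom.continuous

instance compactSpace_sdTop (X : SSet.{u}) [X.Finite] : CompactSpace (sdTop.obj X) :=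
  compactSpace_toTop (SSet.sd.obj X)

instance t2Space_sdTop_stdSimplex (n : SimplexCategory) :
    T2Space (sdTop.{u}.obj (SSet.stdSimplex.obj n)) :=
  .of_injective_continuous sdCoord_injective continuous_sdCoord

section Fibre

variable {m n : ℕ}

/-- The points of `|Sd (Δ[m] × Δ[n])|` over a given point of `|Sd Δ[m]| × |Sd Δ[n]|`. -/
def simplexFibre (d₁ : sdTop.{u}.obj Δ[m]) (d₂ : sdTop.{u}.obj Δ[n]) :
    Set (sdTop.{u}.obj (Δ[m] ⊗ Δ[n])) :=
  {p | sdTop.map (CartesianMonoidalCategory.fst _ _) p = d₁ ∧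
    sdTop.map (CartesianMonoidalCategory.snd _ _) p = d₂}

lemma isClosed_simplexFibre (d₁ : sdTop.{u}.obj Δ[m]) (d₂ : sdTop.{u}.obj Δ[n]) :
    IsClosed (simplexFibre d₁ d₂) :=
  (isClosed_singleton.preimage (sdTop.map (CartesianMonoidalCategory.fst _ _)).hom.continuous).inter
    (isClosed_singleton.preimage (sdTop.map (CartesianMonoidalCategory.snd _ _)).hom.continuous)

lemma mem_simplexFibre_iff {d₁ : sdTop.{u}.obj Δ[m]} {d₂ : sdTop.{u}.obj Δ[n]}
    {p : sdTop.{u}.obj (Δ[m] ⊗ Δ[n])} : p ∈ simplexFibre d₁ d₂ ↔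
      prodCoord m n p ∈ chainMatrices (sdCoord d₁) (sdCoord d₂) := by
  simp only [simplexFibre, chainMatrices, Set.mem_ofPred_eq, ← sdCoord_map_fst, ← sdCoord_map_snd,
    sdCoord_injective.eq_iff]
  exact ⟨fun h => ⟨fun a b ha hb => prodCoord_chain p ha hb, h⟩, fun h => h.2⟩

/-- The fibres over `|Sd Δ[m]| × |Sd Δ[n]|` are spaces of chain-supported matrices. -/
noncomputable def simplexFibreHomeo (d₁ : sdTop.{u}.obj Δ[m]) (d₂ : sdTop.{u}.obj Δ[n]) :
    simplexFibre d₁ d₂ ≃ₜ chainMatrices (sdCoord d₁) (sdCoord d₂) := by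
  have : CompactSpace (simplexFibre d₁ d₂) :=
    isCompact_iff_compactSpace.mp (isClosed_simplexFibre d₁ d₂).isCompact
  let φ : simplexFibre d₁ d₂ → chainMatrices (sdCoord d₁) (sdCoord d₂) :=
    fun p => ⟨prodCoord m n p.1, mem_simplexFibre_iff.mp p.2⟩
  have hφ : Function.Bijective φ := by
    refine ⟨fun p q h => Subtype.ext (prodCoord_injective (congrArg Subtype.val h)), ?_⟩
    rintro ⟨f, hf⟩
    obtain ⟨i, hi⟩ := exists_sdCoord_eq_one d₁
    obtain ⟨a, -, ha⟩ := exists_eq_maxPush (f := Prod.fst) (h := f) (j := i) (by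
      rw [hf.2.1, hi]; exact one_ne_zero)
    obtain ⟨p, rfl⟩ := exists_prodCoord_eq.{u} f
      (fun a => (le_maxPush (f := Prod.fst) a).trans (by rw [hf.2.1]; exact sdCoord_le_one d₁ _))
      ⟨a, by rw [ha, hf.2.1, hi]⟩ hf.1
    exact ⟨⟨p, mem_simplexFibre_iff.mpr hf⟩, rfl⟩
  exact Continuous.homeoOfEquivCompactToT2 (f := Equiv.ofBijective φ hφ)
    ((continuous_prodCoord.comp continuous_subtype_val).subtype_mk _)

variable {X Y : SSet.{u}}

/-- The points of `|Sd (X × Y)|` over a given point of `|Sd X| × |Sd Y|`. -/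
def prodFibre (b₁ : sdTop.obj X) (b₂ : sdTop.obj Y) : Set (sdTop.obj (X ⊗ Y)) :=
  {p | sdTop.map (CartesianMonoidalCategory.fst _ _) p = b₁ ∧
    sdTop.map (CartesianMonoidalCategory.snd _ _) p = b₂}

/-- The map `|Sd (Δ[m] × Δ[n])| ⟶ |Sd (X × Y)|` induced by a pair of simplices. -/
noncomputable def prodCell (x : X _⦋m⦌) (y : Y _⦋n⦌) :
    sdTop.obj (Δ[m] ⊗ Δ[n]) ⟶ sdTop.obj (X ⊗ Y) :=
  sdTop.map (yonedaEquiv.symm x ⊗ₘ yonedaEquiv.symm y)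

lemma prodCell_cell (x : X _⦋m⦌) (y : Y _⦋n⦌) {k : SimplexCategory} (α : k ⟶ ⦋m⦌) (β : k ⟶ ⦋n⦌)
    (e : sdTop.obj (SSet.stdSimplex.obj k)) :
    prodCell x y (cell sdTop (X := Δ[m] ⊗ Δ[n]) (n := k)
      (stdSimplex.objEquiv.symm α, stdSimplex.objEquiv.symm β) e) =
      cell sdTop (X := X ⊗ Y) (n := k) (X.map α.op x, Y.map β.op y) e :=
  map_cell sdTop (X := Δ[m] ⊗ Δ[n]) (n := k) _ _ e

lemma map_fst_cell {k : SimplexCategory} (z : (X ⊗ Y).obj (op k))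
    (e : sdTop.obj (SSet.stdSimplex.obj k)) :
    sdTop.map (CartesianMonoidalCategory.fst X Y) (cell sdTop z e) = cell sdTop z.1 e :=
  map_cell sdTop z _ e

lemma map_snd_cell {k : SimplexCategory} (z : (X ⊗ Y).obj (op k))
    (e : sdTop.obj (SSet.stdSimplex.obj k)) :
    sdTop.map (CartesianMonoidalCategory.snd X Y) (cell sdTop z e) = cell sdTop z.2 e :=
  map_cell sdTop z _ e

lemma cell_mem_simplexFibre_iff {d₁ : sdTop.{u}.obj Δ[m]} {d₂ : sdTop.{u}.obj Δ[n]}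
    {k : SimplexCategory} (α : k ⟶ ⦋m⦌) (β : k ⟶ ⦋n⦌) (e : sdTop.obj (SSet.stdSimplex.obj k)) :
    cell sdTop (X := Δ[m] ⊗ Δ[n]) (n := k)
      (stdSimplex.objEquiv.symm α, stdSimplex.objEquiv.symm β) e ∈ simplexFibre d₁ d₂ ↔
      push sdTop α e = d₁ ∧ push sdTop β e = d₂ :=
  and_congr (Eq.congr_left (map_fst_cell (X := Δ[m]) (Y := Δ[n]) (k := k) _ e))
    (Eq.congr_left (map_snd_cell (X := Δ[m]) (Y := Δ[n]) (k := k) _ e))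

lemma prodCell_mem_prodFibre {x : X _⦋m⦌} {y : Y _⦋n⦌} {d₁ : sdTop.{u}.obj Δ[m]}
    {d₂ : sdTop.{u}.obj Δ[n]} {p : sdTop.obj (Δ[m] ⊗ Δ[n])} (hp : p ∈ simplexFibre d₁ d₂) :
    prodCell x y p ∈ prodFibre (cell sdTop x d₁) (cell sdTop y d₂) := by
  obtain ⟨k, ⟨α, β⟩, e, rfl⟩ := exists_cell sdTop p
  obtain ⟨α, rfl⟩ := stdSimplex.objEquiv.symm.surjective α
  obtain ⟨β, rfl⟩ := stdSimplex.objEquiv.symm.surjective β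
  obtain ⟨rfl, rfl⟩ := (cell_mem_simplexFibre_iff (k := ⦋k⦌) α β e).mp hp
  rw [prodCell_cell]
  exact ⟨(map_fst_cell (X := X) (Y := Y) (k := ⦋k⦌) _ e).trans (cell_map sdTop α x e),
    (map_snd_cell (X := X) (Y := Y) (k := ⦋k⦌) _ e).trans (cell_map sdTop β y e)⟩

variable {x : X _⦋m⦌} {y : Y _⦋n⦌} {d₁ : sdTop.{u}.obj Δ[m]} {d₂ : sdTop.{u}.obj Δ[n]}
  (hx : x ∈ X.nonDegenerate m) (hy : y ∈ Y.nonDegenerate n)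
  (hd₁ : sdSupportData.supp d₁ = Set.univ) (hd₂ : sdSupportData.supp d₂ = Set.univ)

/-- If a point in the interior of the cell of `z` lies in the interior of the cell of the
nondegenerate simplex `x`, then `z` is a degeneracy of `x`. -/
lemma exists_map_eq_of_cell_eq (hx : x ∈ X.nonDegenerate m)
    (hd₁ : sdSupportData.supp d₁ = Set.univ) {k : ℕ} {z : X _⦋k⦌} {e : sdTop.{u}.obj Δ[k]}
    (he : sdSupportData.supp e = Set.univ) (h : cell sdTop z e = cell sdTop x d₁) :
    ∃ α : ⦋k⦌ ⟶ ⦋m⦌, X.map α.op x = z ∧ push sdTop α e = d₁ := by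
  obtain ⟨l, α, hα, ⟨x', hx'⟩, rfl⟩ := X.exists_nonDegenerate z
  rw [cell_map] at h
  have key := sdSupportData.normalForm_unique hx' hx (sdSupportData.supp_push_of_epi α he) hd₁ h
  obtain rfl : l = m := congrArg Sigma.fst key
  simp only [Sigma.mk.injEq, heq_eq_eq, true_and, Prod.mk.injEq] at key
  obtain ⟨rfl, rfl⟩ := key
  exact ⟨α, rfl, rfl⟩

include hx hy hd₁ hd₂ in
lemma exists_map_eq_of_mem_prodFibre {k : ℕ} {z : (X ⊗ Y) _⦋k⦌} {e : sdTop.{u}.obj Δ[k]}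
    (he : sdSupportData.supp e = Set.univ)
    (h : cell sdTop z e ∈ prodFibre (cell sdTop x d₁) (cell sdTop y d₂)) :
    ∃ (α : ⦋k⦌ ⟶ ⦋m⦌) (β : ⦋k⦌ ⟶ ⦋n⦌), z = (X.map α.op x, Y.map β.op y) ∧
      cell sdTop (X := Δ[m] ⊗ Δ[n]) (n := ⦋k⦌)
        (stdSimplex.objEquiv.symm α, stdSimplex.objEquiv.symm β) e ∈ simplexFibre d₁ d₂ := by
  obtain ⟨α, hα, hα'⟩ := exists_map_eq_of_cell_eq hx hd₁ he
    ((map_fst_cell (k := ⦋k⦌) z e).symm.trans h.1)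
  obtain ⟨β, hβ, hβ'⟩ := exists_map_eq_of_cell_eq hy hd₂ he
    ((map_snd_cell (k := ⦋k⦌) z e).symm.trans h.2)
  exact ⟨α, β, (Prod.ext hα hβ).symm, (cell_mem_simplexFibre_iff _ _ _).mpr ⟨hα', hβ'⟩⟩

include hx hy hd₁ hd₂ in
lemma surjOn_prodCell : Set.SurjOn (prodCell x y) (simplexFibre d₁ d₂)
    (prodFibre (cell sdTop x d₁) (cell sdTop y d₂)) := by
  intro q hq
  obtain ⟨k, z, e, -, he, rfl⟩ := sdSupportData.exists_normalForm q
  obtain ⟨α, β, rfl, h⟩ := exists_map_eq_of_mem_prodFibre hx hy hd₁ hd₂ he hq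
  exact ⟨_, h, prodCell_cell x y α β e⟩

include hx hy hd₁ hd₂ in
/-- Over an interior point of the cells of `x` and `y`, only operators which are surjective on
vertices occur, and these are determined by their effect on nondegenerate simplices. -/
lemma injOn_prodCell : Set.InjOn (prodCell x y) (simplexFibre d₁ d₂) := by
  have aux {k : ℕ} {l : ℕ} {d : sdTop.{u}.obj Δ[l]} (hd : sdSupportData.supp d = Set.univ)
      {α : ⦋k⦌ ⟶ ⦋l⦌} {e : sdTop.{u}.obj Δ[k]} (h : push sdTop α e = d) : Epi α := by
    rw [SimplexCategory.epi_iff_surjective, ← Set.range_eq_univ, Set.eq_univ_iff_forall]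
    intro i
    have hi : i ∈ sdSupportData.supp d := by rw [hd]; trivial
    rw [← h, SupportData.supp_push] at hi
    obtain ⟨r, -, hr⟩ := hi
    exact ⟨r, hr⟩
  intro p hp p' hp' h
  obtain ⟨k, ⟨α, β⟩, e, hz, he, rfl⟩ := sdSupportData.exists_normalForm p
  obtain ⟨α, rfl⟩ := stdSimplex.objEquiv.symm.surjective α
  obtain ⟨β, rfl⟩ := stdSimplex.objEquiv.symm.surjective β
  obtain ⟨k', ⟨α', β'⟩, e', hz', he', rfl⟩ := sdSupportData.exists_normalForm p'
  obtain ⟨α', rfl⟩ := stdSimplex.objEquiv.symm.surjective α'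
  obtain ⟨β', rfl⟩ := stdSimplex.objEquiv.symm.surjective β'
  have hm := vertexMap_strictMono hz
  have hm' := vertexMap_strictMono hz'
  obtain ⟨h₁, h₂⟩ := (cell_mem_simplexFibre_iff (k := ⦋k⦌) α β e).mp hp
  obtain ⟨h₁', h₂'⟩ := (cell_mem_simplexFibre_iff (k := ⦋k'⦌) α' β' e').mp hp'
  have := aux hd₁ h₁
  have := aux hd₂ h₂
  have := aux hd₁ h₁'
  have := aux hd₂ h₂'
  replace h := (prodCell_cell (k := ⦋k⦌) x y α β e).symm.trans
    (h.trans (prodCell_cell (k := ⦋k'⦌) x y α' β' e'))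
  have key := sdSupportData.normalForm_unique
    (nonDegenerate_prod_of_injective α β hx hy fun r s h h' => hm.injective (Prod.ext h h'))
    (nonDegenerate_prod_of_injective α' β' hx hy fun r s h h' => hm'.injective (Prod.ext h h'))
    he he' h
  obtain rfl : k = k' := congrArg Sigma.fst key
  simp only [Sigma.mk.injEq, heq_eq_eq, true_and] at key
  obtain rfl : e = e' := congrArg Prod.snd key
  have k₁ := congrArg (fun q => Prod.fst (Prod.fst q)) key
  have k₂ := congrArg (fun q => Prod.snd (Prod.fst q)) key
  obtain rfl := X.unique_nonDegenerate_map _ α ⟨x, hx⟩ rfl α' ⟨x, hx⟩ k₁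
  obtain rfl := Y.unique_nonDegenerate_map _ β ⟨y, hy⟩ rfl β' ⟨y, hy⟩ k₂
  rfl

include hx hy hd₁ hd₂ in
lemma isClosed_image_prodCell {C : Set (sdTop.{u}.obj (Δ[m] ⊗ Δ[n]))} (hC : IsClosed C)
    (hCP : C ⊆ simplexFibre d₁ d₂) : IsClosed (prodCell x y '' C) := by
  refine isClosed_of_cell sdTop fun k z => ?_
  let I := {i : Σ l : Fin (k + 1), (⦋l⦌ ⟶ ⦋k⦌) × (⦋l⦌ ⟶ ⦋m⦌) × (⦋l⦌ ⟶ ⦋n⦌) //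
    (X ⊗ Y).map i.2.1.op z = (X.map i.2.2.1.op x, Y.map i.2.2.2.op y)}
  -- The preimage is a finite union of compact sets, one for each way of writing a face of `z` as a
  -- pair of operators applied to `x` and `y`.
  have key : cell sdTop z ⁻¹' (prodCell x y '' C) = ⋃ i : I, push sdTop i.1.2.1 ''
      (cell sdTop (X := Δ[m] ⊗ Δ[n]) (n := ⦋i.1.1⦌)
        (stdSimplex.objEquiv.symm i.1.2.2.1, stdSimplex.objEquiv.symm i.1.2.2.2) ⁻¹' C) := by
    ext d
    simp only [Set.mem_iUnion]
    constructor
    · rintro ⟨p, hpC, hp⟩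
      obtain ⟨l, ι, e, hι, he, rfl⟩ := sdSupportData.exists_full d
      replace hp : prodCell x y p = cell sdTop ((X ⊗ Y).map ι.op z) e :=
        hp.trans (cell_map sdTop ι z e).symm
      obtain ⟨α, β, hz, hmem⟩ := exists_map_eq_of_mem_prodFibre hx hy hd₁ hd₂ he
        (hp ▸ prodCell_mem_prodFibre (x := x) (y := y) (hCP hpC))
      have hl := SimplexCategory.le_of_mono ι
      refine ⟨⟨⟨⟨l, by lia⟩, ι, α, β⟩, hz⟩, e, ?_, rfl⟩
      have : p = _ := injOn_prodCell hx hy hd₁ hd₂ (hCP hpC) hmem (by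
        rw [hp, hz]
        exact (prodCell_cell (k := ⦋l⦌) x y α β e).symm)
      exact Set.mem_preimage.mpr (this ▸ hpC)
    · rintro ⟨⟨⟨l, ι, α, β⟩, hz⟩, e, he, rfl⟩
      refine ⟨_, he, ?_⟩
      refine (prodCell_cell x y α β e).trans ?_
      rw [← cell_map, ← hz]
  rw [key]
  refine isClosed_iUnion_of_finite fun i => ?_
  exact (((hC.preimage (cell sdTop _).hom.continuous).isCompact).image
    (push sdTop _).hom.continuous).isClosed

include hx hy hd₁ hd₂ in
/-- The fibre over a point in the interiors of the cells of `x` and `y` is the corresponding fibre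
for the two simplices. -/
lemma nonempty_simplexFibre_homeo_prodFibre :
    Nonempty (simplexFibre d₁ d₂ ≃ₜ prodFibre (cell sdTop x d₁) (cell sdTop y d₂)) := by
  let φ : simplexFibre d₁ d₂ → prodFibre (cell sdTop x d₁) (cell sdTop y d₂) :=
    fun p => ⟨prodCell x y p.1, prodCell_mem_prodFibre p.2⟩
  have hφ : Function.Bijective φ := by
    refine ⟨fun p q h => Subtype.ext
      (injOn_prodCell hx hy hd₁ hd₂ p.2 q.2 (congrArg Subtype.val h)), ?_⟩
    rintro ⟨q, hq⟩
    obtain ⟨p, hp, rfl⟩ := surjOn_prodCell hx hy hd₁ hd₂ hq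
    exact ⟨⟨p, hp⟩, rfl⟩
  refine ⟨(Equiv.ofBijective φ hφ).toHomeomorphOfContinuousClosed
    (((prodCell x y).hom.continuous.comp continuous_subtype_val).subtype_mk _) fun C hC => ?_⟩
  have h := isClosed_image_prodCell hx hy hd₁ hd₂ (x := x) (y := y)
    ((isClosed_simplexFibre d₁ d₂).isClosedMap_subtype_val C hC) (by simp)
  convert! h.preimage continuous_subtype_val using 1
  ext q
  simp only [Equiv.ofBijective_apply, Set.mem_image, Set.mem_preimage, Subtype.exists]
  constructor
  · rintro ⟨p, hp, hpC, rfl⟩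
    exact ⟨p, ⟨p, hp, hpC, rfl⟩, rfl⟩
  · rintro ⟨_, ⟨p, hp, hpC, rfl⟩, h⟩
    exact ⟨p, hp, hpC, Subtype.ext h⟩

end Fibre

lemma contractibleSpace_prodFibre {X Y : SSet.{u}} (b₁ : sdTop.obj X) (b₂ : sdTop.obj Y) :
    ContractibleSpace (prodFibre b₁ b₂) := by
  obtain ⟨m, x, d₁, hx, hd₁, rfl⟩ := sdSupportData.exists_normalForm b₁
  obtain ⟨n, y, d₂, hy, hd₂, rfl⟩ := sdSupportData.exists_normalForm b₂
  obtain ⟨φ⟩ := nonempty_simplexFibre_homeo_prodFibre hx hy hd₁ hd₂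
  have hsup {k : ℕ} (d : sdTop.{u}.obj Δ[k]) : Finset.univ.sup (sdCoord d) = 1 := by
    obtain ⟨i, hi⟩ := exists_sdCoord_eq_one d
    exact le_antisymm (Finset.sup_le fun i _ => sdCoord_le_one d i)
      (hi.symm.trans_le (Finset.le_sup (Finset.mem_univ i)))
  have := contractibleSpace_chainMatrices ((hsup d₁).trans (hsup d₂).symm)
  exact (φ.symm.trans (simplexFibreHomeo d₁ d₂)).contractibleSpace

/-- The point inverses of `|κ|` are common fibres of the two projections, because a point of
`|Sd X × Sd Y|` is determined by its images in `|Sd X|` and `|Sd Y|`. -/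
lemma preimage_sdProdComparison {X Y : SSet.{u}}
    (b : SSet.toTop.obj (SSet.sd.obj X ⊗ SSet.sd.obj Y)) :
    SSet.toTop.map (SSet.sdProdComparison X Y) ⁻¹' {b} =
      prodFibre (SSet.toTop.map (CartesianMonoidalCategory.fst _ _) b)
        (SSet.toTop.map (CartesianMonoidalCategory.snd _ _) b) := by
  have e₁ (p : SSet.toTop.obj (SSet.sd.obj (X ⊗ Y))) :
      SSet.toTop.map (CartesianMonoidalCategory.fst _ _)
        (SSet.toTop.map (SSet.sdProdComparison X Y) p) =
      SSet.toTop.map (SSet.sd.map (CartesianMonoidalCategory.fst X Y)) p := by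
    rw [← CartesianMonoidalCategory.lift_fst (SSet.sd.map (CartesianMonoidalCategory.fst X Y))
      (SSet.sd.map (CartesianMonoidalCategory.snd X Y)), SSet.toTop.map_comp]
    rfl
  have e₂ (p : SSet.toTop.obj (SSet.sd.obj (X ⊗ Y))) :
      SSet.toTop.map (CartesianMonoidalCategory.snd _ _)
        (SSet.toTop.map (SSet.sdProdComparison X Y) p) =
      SSet.toTop.map (SSet.sd.map (CartesianMonoidalCategory.snd X Y)) p := by
    rw [← CartesianMonoidalCategory.lift_snd (SSet.sd.map (CartesianMonoidalCategory.fst X Y))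
      (SSet.sd.map (CartesianMonoidalCategory.snd X Y)), SSet.toTop.map_comp]
    rfl
  ext p
  constructor
  · rintro rfl
    exact ⟨(e₁ p).symm, (e₂ p).symm⟩
  · rintro ⟨h₁, h₂⟩
    exact toTop_prod_ext ((e₁ p).trans h₁) ((e₂ p).trans h₂)

end SSet

theorem theorem1p2 (X Y : SSet.{u}) (hX : X.Finite) (hY : Y.Finite) :
    SSet.IsSimpleMap (SSet.sdProdComparison X Y) where
  finite_source := inferInstance
  finite_target := inferInstance
  contractible_preimage b := by
    rw [SSet.preimage_sdProdComparison]
    exact SSet.contractibleSpace_prodFibre _ _
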